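/- Let $x\odot y=x_1y_1+x_2y_2+x_3y_3-x_4y_4$ on $\mathbb{R}^4$ and $\mathbb{M}=\{x\in\mathbb{R}^4 : x\odot x=-1\}$. Let $m_1,\dots,m_n>0$. Let $q_1,\dots,q_n$ be a solution, on a nonempty open interval $I$, of the $n$-body problem on $\mathbb{M}$, $$\ddot q_i=\sum_{j\neq i}\frac{m_j\,(q_j+(q_i\odot q_j)q_i)}{((q_i\odot q_j)^2-1)^{3/2}}+(\dot q_i\odot\dot q_i)\,q_i ,\qquad i=1,\dots,n,$$ without singularities, i.e. $(q_i\odot q_j)^2\neq 1$ for $i\ne j$. Put $$T(x)=\begin{pmatrix}\cos x&-\sin x\\ \sin x&\cos x\end{pmatrix},\quad S(x)=\begin{pmatrix}\cosh x&\sinh x\\ \sinh x&\cosh x\end{pmatrix},\quad R(a,b)=\begin{pmatrix}T(a)&0\\0&S(b)\end{pmatrix}.$$ Suppose that the $q_i(t)$ are the vertices of a polygon for every $t\in I$ (that is, $n\ge 3$ and they are pairwise distinct), and that there are twice differentiable functions $x_i,y_i,\phi$ and $\rho\ge 0$ on $I$ and constants $\beta_i\in\mathbb{R}$ with $x_i^2+y_i^2-\rho^2=-1$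 and $$q_i=\begin{pmatrix}x_i\\ y_i\\ \rho\,S(\phi)\begin{pmatrix}\sinh\beta_i\\ \cosh\beta_i\end{pmatrix}\end{pmatrix},\qquad i=1,\dots,n.$$ Call $q_1,\dots,q_n$ a *negative hyperbolic polygonal rotopulsator* if, moreover, the shape of the configuration stays the same: for all $s,t\in I$ there is $\lambda>0$ such that $(q_i-q_j)\odot(q_i-q_j)$ at time $t$ is $\lambda$ times its value at time $s$, for all $i,j$. Call it a *negative elliptic-hyperbolic polygonal rotopulsator* if instead there are twice differentiable functions $\theta$ and $r\ge 0$ with $r^2-\rho^2=-1$ and constants $\alpha_i\in[0,2\pi]$ such that $\binom{x_i}{y_i}=r\,T(\theta)\binom{\sin\alpha_i}{\cos\alpha_i}$ for all $i$. **Theorem.** Let $q_1,\dots,q_n$ be a negative hyperbolic or a negative elliptic-hyperbolic polygonal rotopulsator. 1. If $\rho$ is not constant, then at every time $t\in I$ the points $q_1(t),\dots,q_n(t)$ are, in some order, the vertices of a regular polygon: they are equally spaced on a circle of positive radius, with respect to $\odot$, in an affine plane whose direction is spanned by two $\odot$-orthonormal vectors $u,v$ with $u\odot u=v\odot v=1$,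 the centre of the circle being $\odot$-orthogonal to $u$ and $v$. 2. If $\rho$ is constant, then $q_1,\dots,q_n$ is a polygonal relative equilibrium: there are constants $A,B$ and points $Q_1,\dots,Q_n$ with $q_i(t)=R(At,Bt)\,Q_i$ for all $t\in I$ and all $i$. It is unique in the following sense. The projections of the $Q_i$ to the plane of the first two coordinates are nonzero and have pairwise distinct directions, hence are met in a certain cyclic order when one goes round the origin once in a fixed direction. Let $q'_i(t)=R(A't,B't)\,Q'_i$ be any negative hyperbolic or negative elliptic-hyperbolic polygonal rotopulsator (on any nonempty open interval) with the same masses $m_1,\dots,m_n$, with constant size function $\rho'$ and with the same cyclic order of the labelled point masses. If $\rho'=\rho$ or $A'^2+B'^2=A^2+B^2$, then there are $a,b\in\mathbb{R}$ with $Q'_i=R(a,b)\,Q_i$ for all $i$. In particular, for given masses, cyclic order and rates $A,B$ there is, up to the constant phases $a,b$, at most one such solution. -/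

import Mathlib

open scoped Matrix

noncomputable section

/-- The product `x ⊙ y = x₁y₁ + x₂y₂ + x₃y₃ - x₄y₄` on `ℝ⁴` (the case `σ = -1`). -/
def mink (x y : Fin 4 → ℝ) : ℝ :=
  x 0 * y 0 + x 1 * y 1 + x 2 * y 2 - x 3 * y 3

/-- The right-hand side of the equations of motion for `σ = -1`, for masses `m`, positions `p`
and velocities `v`. -/
def acceleration {n : ℕ} (m : Fin n → ℝ) (p v : Fin n → Fin 4 → ℝ) (i : Fin n) : Fin 4 → ℝ :=
  (∑ j ∈ Finset.univ.erase i,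
      (m j / (mink (p i) (p j) ^ 2 - 1) ^ (3 / 2 : ℝ)) • (p j + mink (p i) (p j) • p i))
    + mink (v i) (v i) • p i

/-- `q₁, …, qₙ` solve the `n`-body problem with masses `m` on the hyperboloid `q ⊙ q = -1`,
on the nonempty open time interval `I`. The field `regular` says that none of the denominators
in the equations of motion vanishes (on one sheet of the hyperboloid: no collisions). -/
structure IsSolution {n : ℕ} (m : Fin n → ℝ) (I : Set ℝ) (q : Fin n → ℝ → Fin 4 → ℝ) : Prop where
  nonempty : I.Nonempty
  isOpen : IsOpen I
  ordConnected : I.OrdConnected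
  mem_hyperboloid : ∀ i, ∀ t ∈ I, mink (q i t) (q i t) = -1
  regular : ∀ t ∈ I, ∀ i j, i ≠ j → mink (q i t) (q j t) ^ 2 ≠ 1
  motion : ∃ v : Fin n → ℝ → Fin 4 → ℝ, ∀ t ∈ I, ∀ i,
    HasDerivAt (q i) (v i t) t ∧
      HasDerivAt (v i) (acceleration m (fun j => q j t) (fun j => v j t) i) t

/-- Rotation matrix. -/
def T (x : ℝ) : Matrix (Fin 2) (Fin 2) ℝ :=
  !![Real.cos x, -Real.sin x; Real.sin x, Real.cos x]

/-- Hyperbolic rotation matrix. -/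
def S (x : ℝ) : Matrix (Fin 2) (Fin 2) ℝ :=
  !![Real.cosh x, Real.sinh x; Real.sinh x, Real.cosh x]

/-- The vector of `ℝ⁴` whose first two coordinates are `u` and whose last two are `w`. -/
def join (u w : Fin 2 → ℝ) : Fin 4 → ℝ := ![u 0, u 1, w 0, w 1]

/-- The isometry of `ℝ⁴` that acts by `T a` on the first two and by `S b` on the last two
coordinates. -/
def rotate (a b : ℝ) (p : Fin 4 → ℝ) : Fin 4 → ℝ :=
  join (T a *ᵥ ![p 0, p 1]) (S b *ᵥ ![p 2, p 3])

/-- `f` is twice differentiable on the open set `I`. -/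
def TwiceDifferentiableOn (f : ℝ → ℝ) (I : Set ℝ) : Prop :=
  ∀ t ∈ I, DifferentiableAt ℝ f t ∧ DifferentiableAt ℝ (deriv f) t

/-- The points `p₁, …, pₙ` are the vertices of a polygon: there are at least three of them and
no two coincide. -/
def IsPolygon {n : ℕ} (p : Fin n → Fin 4 → ℝ) : Prop :=
  3 ≤ n ∧ Function.Injective p

/-- The configurations `p` and `p'` have the same shape: all squared `⊙`-distances between
vertices agree up to one common positive factor. -/
def SameShape {n : ℕ} (p p' : Fin n → Fin 4 → ℝ) : Prop :=
  ∃ c : ℝ, 0 < c ∧ ∀ i j, mink (p' i - p' j) (p' i - p' j) = c * mink (p i - p j) (p i - p j)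

/-- The coordinate form common to both classes:
`qᵢ = (xᵢ, yᵢ, ρ S(φ) (sinh βᵢ, cosh βᵢ))` with `xᵢ² + yᵢ² - ρ² = -1` and `ρ ≥ 0`. -/
def HyperbolicForm {n : ℕ} (I : Set ℝ) (q : Fin n → ℝ → Fin 4 → ℝ) (ρ : ℝ → ℝ)
    (x y : Fin n → ℝ → ℝ) : Prop :=
  TwiceDifferentiableOn ρ I ∧ (∀ t ∈ I, 0 ≤ ρ t) ∧
  (∀ i, TwiceDifferentiableOn (x i) I ∧ TwiceDifferentiableOn (y i) I) ∧
  (∀ i, ∀ t ∈ I, x i t ^ 2 + y i t ^ 2 - ρ t ^ 2 = -1) ∧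
  ∃ (φ : ℝ → ℝ) (β : Fin n → ℝ), TwiceDifferentiableOn φ I ∧
    ∀ i, ∀ t ∈ I, q i t =
      join ![x i t, y i t] (ρ t • (S (φ t) *ᵥ ![Real.sinh (β i), Real.cosh (β i)]))

/-- Negative hyperbolic polygonal rotopulsator with size function `ρ`. -/
structure IsNegativeHyperbolic {n : ℕ} (m : Fin n → ℝ) (I : Set ℝ) (q : Fin n → ℝ → Fin 4 → ℝ)
    (ρ : ℝ → ℝ) : Prop where
  solution : IsSolution m I q
  form : ∃ x y : Fin n → ℝ → ℝ, HyperbolicForm I q ρ x y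
  polygon : ∀ t ∈ I, IsPolygon (fun i => q i t)
  shape : ∀ s ∈ I, ∀ t ∈ I, SameShape (fun i => q i s) (fun i => q i t)

/-- Negative elliptic-hyperbolic polygonal rotopulsator with size function `ρ`; here
`(xᵢ, yᵢ) = r T(θ) (sin αᵢ, cos αᵢ)`. -/
structure IsNegativeEllipticHyperbolic {n : ℕ} (m : Fin n → ℝ) (I : Set ℝ)
    (q : Fin n → ℝ → Fin 4 → ℝ) (ρ : ℝ → ℝ) : Prop where
  solution : IsSolution m I q
  form : ∃ x y : Fin n → ℝ → ℝ, HyperbolicForm I q ρ x y ∧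
    ∃ (r θ : ℝ → ℝ) (α : Fin n → ℝ),
      TwiceDifferentiableOn r I ∧ TwiceDifferentiableOn θ I ∧
      (∀ t ∈ I, 0 ≤ r t ∧ r t ^ 2 - ρ t ^ 2 = -1) ∧
      (∀ i, α i ∈ Set.Icc 0 (2 * Real.pi)) ∧
      ∀ i, ∀ t ∈ I, ![x i t, y i t] = r t • (T (θ t) *ᵥ ![Real.sin (α i), Real.cos (α i)])
  polygon : ∀ t ∈ I, IsPolygon (fun i => q i t)

/-- The two classes together. -/
def IsRotopulsator {n : ℕ} (m : Fin n → ℝ) (I : Set ℝ) (q : Fin n → ℝ → Fin 4 → ℝ)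
    (ρ : ℝ → ℝ) : Prop :=
  IsNegativeHyperbolic m I q ρ ∨ IsNegativeEllipticHyperbolic m I q ρ

/-- `p₁, …, pₙ` are, in some order, the vertices of a regular `n`-gon: they are equally spaced on
a circle with centre `c` and radius `R` in a plane spanned by `⊙`-orthonormal spacelike vectors
`u`, `v`, both `⊙`-orthogonal to `c`. -/
def IsRegularPolygon {n : ℕ} (p : Fin n → Fin 4 → ℝ) : Prop :=
  ∃ (c u v : Fin 4 → ℝ) (R : ℝ) (τ : Equiv.Perm (Fin n)),
    0 < R ∧ mink u u = 1 ∧ mink v v = 1 ∧ mink u v = 0 ∧ mink c u = 0 ∧ mink c v = 0 ∧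
    ∀ k : Fin n, p (τ k) =
      c + (R * Real.cos (2 * Real.pi * k / n)) • u + (R * Real.sin (2 * Real.pi * k / n)) • v

/-- The motion `q` is, on `I`, a relative equilibrium: the configuration `Q` is carried along
rigidly with constant rates `A` (elliptic) and `B` (hyperbolic). -/
def IsRelativeEquilibrium {n : ℕ} (I : Set ℝ) (q : Fin n → ℝ → Fin 4 → ℝ) (A B : ℝ)
    (Q : Fin n → Fin 4 → ℝ) : Prop :=
  ∀ i, ∀ t ∈ I, q i t = rotate (A * t) (B * t) (Q i)

/-- Going once round the origin of the plane of the first two coordinates, in the direction of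
growing angle `α`, where `α` is measured as in `(sin α, cos α)`, one meets the points in the order
`σ 0, σ 1, …, σ (n - 1)`. -/
def HasCyclicOrder {n : ℕ} (σ : Equiv.Perm (Fin n)) (Q : Fin n → Fin 4 → ℝ) : Prop :=
  ∃ α : Fin n → ℝ, StrictMono (α ∘ σ) ∧ (∀ i j, α i - α j < 2 * Real.pi) ∧
    ∀ i, ∃ s : ℝ, 0 < s ∧ Q i 0 = s * Real.sin (α i) ∧ Q i 1 = s * Real.cos (α i)

end

/-!
A solution in hyperbolic form moves over a single point of the plane of the last two coordinates:
the hyperbolic angular momentum per unit mass does not depend on the mass, so its derivative, which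
is a combination of `sinh (β i - β j)` with positive coefficients, is the same for the largest and
the smallest `β i`, and all `β i` agree (`boost_eq`). What remains (`exists_isPlanarMotion`) is a
motion in the plane of the first two coordinates, on a circle of radius `r` with `r² = ρ² - 1`,
under an attraction that depends on the squared planar distance `E` through the coefficient
`(E (1 + E / 4)) ^ (-3 / 2)`, together with a central force common to all masses.

Both classes of rotopulsators move rigidly on this circle. For the hyperbolic class this follows
from the constant shape, because a triangle determines its circumradius (`isRigid_of_sameShape`).
In a rigid motion the angular momentum per unit mass is again common to all masses; as the total
torque is zero, every tangential force vanishes (`IsPlanarMotion.tangential`).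

If `ρ` is not constant, the tangential forces vanish for an interval of values of `r²`. As
functions of `r²`, the coefficients for different distances are linearly independent
(`sum_fiber_eq_zero`), so the configuration is symmetric under the reflection in each of its points
(`reflection_of_tangential`), hence equally spaced (`equally_spaced_of_reflection`).

If `ρ` is constant, the conserved angular momenta make the motion a relative equilibrium with
constant rates `A` and `B`, and its planar projection is a central configuration with constant
`ω = A² + B²` on a circle centred at the origin. Such configurations are critical points of a
function of `(log r, α)` that is strictly concave, modulo rotations, on the set of configurations of
a given cyclic order. Comparing the gradients of its interaction part at two critical points shows
that they agree up to a rotation, provided that `r` or `ω` agree (`IsCentralConfiguration.unique`).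
-/

noncomputable section

/-! ### Central configurations on a circle -/

/-- The tangent line of `log ∘ sin` at `x` lies strictly above the graph on `(0, π)`. -/
theorem log_sin_sub_lt {x y : ℝ} (hx : x ∈ Set.Ioo 0 Real.pi) (hy : y ∈ Set.Ioo 0 Real.pi)
    (hxy : x ≠ y) :
    Real.log (Real.sin y) - Real.log (Real.sin x) < Real.cos x / Real.sin x * (y - x) := by
  have sx : 0 < Real.sin x := Real.sin_pos_of_mem_Ioo hx
  have sy : 0 < Real.sin y := Real.sin_pos_of_mem_Ioo hy
  have hlog : Real.log (Real.sin y) - Real.log (Real.sin x) ≤ Real.sin y / Real.sin x - 1 := by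
    rw [← Real.log_div sy.ne' sx.ne']
    exact Real.log_le_sub_one_of_pos (div_pos sy sx)
  have hsin : Real.sin y - Real.sin x < Real.cos x * (y - x) := by
    rcases lt_or_gt_of_ne hxy with h | h
    · have := strictConcaveOn_sin_Icc.slope_lt_of_hasDerivAt
        (Set.Ioo_subset_Icc_self hx) (Set.Ioo_subset_Icc_self hy) h (Real.hasDerivAt_sin x)
      rwa [slope_def_field, div_lt_iff₀ (sub_pos.2 h)] at this
    · have := strictConcaveOn_sin_Icc.lt_slope_of_hasDerivAt
        (Set.Ioo_subset_Icc_self hy) (Set.Ioo_subset_Icc_self hx) h (Real.hasDerivAt_sin x)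
      rw [slope_def_field, lt_div_iff₀ (sub_pos.2 h)] at this
      linarith
  calc _ ≤ _ := hlog
    _ = (Real.sin y - Real.sin x) / Real.sin x := by field_simp
    _ < Real.cos x * (y - x) / Real.sin x := by gcongr
    _ = _ := by ring

/-- With `c = q ⊙ q'` and `E = (q - q') ⊙ (q - q')` for two points of the hyperboloid,
`c ^ 2 - 1 = E * (1 + E / 4)`, so the interaction coefficient per unit mass is
`pairForce E`. -/
def pairForce (E : ℝ) : ℝ := 1 / (E * (1 + E / 4)) ^ (3 / 2 : ℝ)

theorem pairForce_pos {E : ℝ} (hE : 0 < E) : 0 < pairForce E := by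
  unfold pairForce; positivity

theorem strictAntiOn_mul_pairForce : StrictAntiOn (fun E => E * pairForce E) (Set.Ioi 0) := by
  have key : ∀ E : ℝ, 0 < E →
      E * pairForce E = 1 / (E ^ (1 / 2 : ℝ) * (1 + E / 4) ^ (3 / 2 : ℝ)) := by
    intro E hE
    have h1 : E ^ (3 / 2 : ℝ) = E * E ^ (1 / 2 : ℝ) := by
      rw [show (3 / 2 : ℝ) = 1 + 1 / 2 by norm_num, Real.rpow_add hE, Real.rpow_one]
    unfold pairForce
    rw [Real.mul_rpow hE.le (by positivity), h1]
    field_simp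
  intro E hE E' hE' h
  have hE : 0 < E := hE
  have hE' : 0 < E' := hE'
  simp only [key E hE, key E' hE']
  gcongr

/-- Squared distance of two points with angular distance `x` on a circle of radius `r`. -/
def chordSq (r x : ℝ) : ℝ := 2 * r ^ 2 * (1 - Real.cos x)

theorem chordSq_two_mul (r u : ℝ) : chordSq r (2 * u) = (2 * r * Real.sin u) ^ 2 := by
  unfold chordSq
  rw [Real.cos_two_mul]
  linear_combination -4 * r ^ 2 * Real.sin_sq_add_cos_sq u

/-- The interaction potential of one pair of points on a circle is strictly concave in `log r` and
half the angular distance `u`: the increment of its gradient has negative product with the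
increment of the coordinates. This holds since `E * pairForce E` is decreasing and `log ∘ sin` is
concave. -/
theorem pair_gradient_neg {r s u w : ℝ} (hr : 0 < r) (hs : 0 < s)
    (hu : u ∈ Set.Ioo 0 Real.pi) (hw : w ∈ Set.Ioo 0 Real.pi) (hne : r ≠ s ∨ u ≠ w) :
    (chordSq s (2 * w) * pairForce (chordSq s (2 * w))
        - chordSq r (2 * u) * pairForce (chordSq r (2 * u))) * (Real.log s - Real.log r)
      + (chordSq s (2 * w) * pairForce (chordSq s (2 * w)) * (Real.cos w / Real.sin w)
        - chordSq r (2 * u) * pairForce (chordSq r (2 * u)) * (Real.cos u / Real.sin u)) * (w - u)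
      < 0 := by
  have su : 0 < Real.sin u := Real.sin_pos_of_mem_Ioo hu
  have sw : 0 < Real.sin w := Real.sin_pos_of_mem_Ioo hw
  rw [chordSq_two_mul, chordSq_two_mul]
  set a := 2 * r * Real.sin u with ha
  set b := 2 * s * Real.sin w with hb
  have ha0 : 0 < a := by positivity
  have hb0 : 0 < b := by positivity
  have hP : 0 < a ^ 2 * pairForce (a ^ 2) := mul_pos (by positivity) (pairForce_pos (by positivity))
  have hQ : 0 < b ^ 2 * pairForce (b ^ 2) := mul_pos (by positivity) (pairForce_pos (by positivity))
  set P := a ^ 2 * pairForce (a ^ 2) with hPdef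
  set Q := b ^ 2 * pairForce (b ^ 2) with hQdef
  have hlog : Real.log b - Real.log a
      = (Real.log s - Real.log r) + (Real.log (Real.sin w) - Real.log (Real.sin u)) := by
    rw [ha, hb, Real.log_mul (by positivity) sw.ne', Real.log_mul (by positivity) su.ne',
      Real.log_mul two_ne_zero hs.ne', Real.log_mul two_ne_zero hr.ne']
    ring
  have hanti : a ≠ b → (Q - P) * (Real.log b - Real.log a) < 0 := by
    intro hab
    rcases lt_or_gt_of_ne hab with h | h
    · have h1 : Q < P := strictAntiOn_mul_pairForce (show 0 < a ^ 2 by positivity)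
        (show 0 < b ^ 2 by positivity) (by gcongr)
      have h2 := Real.log_lt_log ha0 h
      nlinarith
    · have h1 : P < Q := strictAntiOn_mul_pairForce (show 0 < b ^ 2 by positivity)
        (show 0 < a ^ 2 by positivity) (by gcongr)
      have h2 := Real.log_lt_log hb0 h
      nlinarith
  have hanti' : (Q - P) * (Real.log b - Real.log a) ≤ 0 := by
    by_cases hab : a = b
    · rw [hab]; simp
    · exact (hanti hab).le
  by_cases huw : u = w
  · subst huw
    have hrs : r ≠ s := by simpa using hne
    have hab : a ≠ b := by
      rw [ha, hb]
      intro h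
      exact hrs (by simpa [su.ne'] using h)
    have := hanti hab
    rw [hlog] at this
    simpa using this
  · have h1 := log_sin_sub_lt hu hw huw
    have h2 := log_sin_sub_lt hw hu (Ne.symm huw)
    rw [hlog] at hanti'
    nlinarith [mul_pos hP (sub_pos.2 h1), mul_pos hQ (sub_pos.2 h2)]

/-- The points at angles `α i` on a circle of radius `r` form a planar central configuration: the
total attraction on each mass points to the centre and equals `ω` times the distance from it. The
first equation is its tangential, the second its radial component. -/
structure IsCentralConfiguration {n : ℕ} (m : Fin n → ℝ) (r ω : ℝ) (α : Fin n → ℝ) : Prop where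
  radius_pos : 0 < r
  tangential : ∀ i, ∑ j ∈ Finset.univ.erase i,
    m j * pairForce (chordSq r (α j - α i)) * Real.sin (α j - α i) = 0
  radial : ∀ i, ∑ j ∈ Finset.univ.erase i,
    m j * pairForce (chordSq r (α j - α i)) * (1 - Real.cos (α j - α i)) = ω

/-- An antisymmetric double sum against a gradient `δ j - δ i` vanishes. -/
theorem sum_mul_sub_eq_zero {n : ℕ} (m : Fin n → ℝ) (f : Fin n → Fin n → ℝ)
    (hanti : ∀ i j, f j i = - f i j) (h0 : ∀ i, ∑ j, m j * f i j = 0) (δ : Fin n → ℝ) :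
    ∑ i, ∑ j, m i * m j * (f i j * (δ j - δ i)) = 0 := by
  have h1 : ∑ i, ∑ j, m i * m j * (f i j * δ i) = 0 := by
    refine Finset.sum_eq_zero fun i _ => ?_
    have : ∑ j, m i * m j * (f i j * δ i) = m i * δ i * ∑ j, m j * f i j := by
      rw [Finset.mul_sum]; exact Finset.sum_congr rfl fun j _ => by ring
    rw [this, h0, mul_zero]
  have h2 : ∑ i, ∑ j, m i * m j * (f i j * δ j) = 0 := by
    rw [Finset.sum_comm]
    refine Finset.sum_eq_zero fun j _ => ?_
    have : ∑ i, m i * m j * (f i j * δ j) = -(m j * δ j) * ∑ i, m i * f j i := by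
      rw [Finset.mul_sum]; exact Finset.sum_congr rfl fun i _ => by rw [hanti i j]; ring
    rw [this, h0, mul_zero]
  simp only [mul_sub, Finset.sum_sub_distrib]
  rw [h1, h2, sub_zero]

/-- Two points on the circle contribute the tangential term `E * pairForce E * cot u`, with
`u` half their angular distance. -/
theorem chordSq_mul_cot {r u : ℝ} (hu : Real.sin u ≠ 0) :
    chordSq r (2 * u) * (Real.cos u / Real.sin u) = 2 * r ^ 2 * Real.sin (2 * u) := by
  rw [chordSq_two_mul, Real.sin_two_mul]
  field_simp

/-- Uniqueness of central configurations on a circle with given cyclic order. The hypothesis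
`hsign` covers both equal radii and equal `ω`. -/
theorem IsCentralConfiguration.unique {n : ℕ} (hn : 3 ≤ n) {m : Fin n → ℝ} (hm : ∀ i, 0 < m i)
    {r ω r' ω' : ℝ} {α α' : Fin n → ℝ}
    (h : IsCentralConfiguration m r ω α) (h' : IsCentralConfiguration m r' ω' α')
    (horder : ∀ i j, i ≠ j → (α j - α i ∈ Set.Ioo 0 (2 * Real.pi) ∧
        α' j - α' i ∈ Set.Ioo 0 (2 * Real.pi)) ∨
      (α i - α j ∈ Set.Ioo 0 (2 * Real.pi) ∧ α' i - α' j ∈ Set.Ioo 0 (2 * Real.pi)))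
    (hsign : 0 ≤ (ω' * r' ^ 2 - ω * r ^ 2) * (Real.log r' - Real.log r)) :
    r' = r ∧ ∀ i j, α' j - α j = α' i - α i := by
  have hr := h.radius_pos
  have hr' := h'.radius_pos
  let P : Fin n → Fin n → ℝ := fun i j =>
    if i = j then 0 else chordSq r (α j - α i) * pairForce (chordSq r (α j - α i))
  let P' : Fin n → Fin n → ℝ := fun i j =>
    if i = j then 0 else chordSq r' (α' j - α' i) * pairForce (chordSq r' (α' j - α' i))
  let κ : Fin n → Fin n → ℝ := fun i j => Real.cos ((α j - α i) / 2) / Real.sin ((α j - α i) / 2)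
  let κ' : Fin n → Fin n → ℝ := fun i j =>
    Real.cos ((α' j - α' i) / 2) / Real.sin ((α' j - α' i) / 2)
  let D : Fin n → Fin n → ℝ := fun i j =>
    (P' i j - P i j) * (Real.log r' - Real.log r)
      + (P' i j * κ' i j - P i j * κ i j) * ((α' j - α' i) / 2 - (α j - α i) / 2)
  -- each pair contributes a negative amount unless it is unchanged
  have hD : ∀ i j, i ≠ j → (r ≠ r' ∨ α' j - α' i ≠ α j - α i) → D i j < 0 := by
    intro i j hij hne
    simp only [D, P, P', κ, κ', if_neg hij]
    rcases horder i j hij with ⟨h1, h2⟩ | ⟨h1, h2⟩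
    · have := pair_gradient_neg (u := (α j - α i) / 2) (w := (α' j - α' i) / 2) hr hr'
        ⟨by linarith [h1.1], by linarith [h1.2]⟩ ⟨by linarith [h2.1], by linarith [h2.2]⟩
        (hne.imp_right fun h3 h4 => h3 (by linarith))
      simpa only [mul_div_cancel₀ _ (two_ne_zero (α := ℝ))] using this
    · have := pair_gradient_neg (u := (α i - α j) / 2) (w := (α' i - α' j) / 2) hr hr'
        ⟨by linarith [h1.1], by linarith [h1.2]⟩ ⟨by linarith [h2.1], by linarith [h2.2]⟩
        (hne.imp_right fun h3 h4 => h3 (by linarith))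
      simp only [mul_div_cancel₀ _ (two_ne_zero (α := ℝ))] at this
      have e1 : α j - α i = -(α i - α j) := by ring
      have e2 : α' j - α' i = -(α' i - α' j) := by ring
      rw [e1, e2]
      simp only [chordSq, Real.cos_neg, neg_div, Real.sin_neg, div_neg] at this ⊢
      linarith
  have hDle : ∀ i j, D i j ≤ 0 := by
    intro i j
    by_cases hij : i = j
    · simp [D, P, P', hij]
    · by_cases hne : r ≠ r' ∨ α' j - α' i ≠ α j - α i
      · exact (hD i j hij hne).le
      · push Not at hne
        simp [D, P, P', κ, κ', hne.1, hne.2]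
  have erase_sum : ∀ (f : Fin n → ℝ) i, f i = 0 →
      ∑ j, f j = ∑ j ∈ Finset.univ.erase i, f j := fun f i hi =>
    (Finset.sum_erase _ hi).symm
  have sin_ne : ∀ x : ℝ, (x ∈ Set.Ioo 0 (2 * Real.pi) ∨ -x ∈ Set.Ioo 0 (2 * Real.pi)) →
      Real.sin (x / 2) ≠ 0 := by
    rintro x (hx | hx)
    · exact (Real.sin_pos_of_mem_Ioo ⟨by linarith [hx.1], by linarith [hx.2]⟩).ne'
    · have : 0 < Real.sin (-(x / 2)) :=
        Real.sin_pos_of_mem_Ioo ⟨by linarith [hx.1], by linarith [hx.2]⟩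
      rw [Real.sin_neg] at this
      linarith
  have tang : ∀ (r ω : ℝ) (α : Fin n → ℝ), IsCentralConfiguration m r ω α →
      (∀ i j, i ≠ j → Real.sin ((α j - α i) / 2) ≠ 0) → ∀ i,
      ∑ j, m j * ((if i = j then 0 else
        chordSq r (α j - α i) * pairForce (chordSq r (α j - α i)))
        * (Real.cos ((α j - α i) / 2) / Real.sin ((α j - α i) / 2))) = 0 := by
    intro r ω α hc hsin i
    rw [erase_sum _ i (by simp)]
    have := hc.tangential i
    rw [← mul_eq_zero_of_right (2 * r ^ 2) this, Finset.mul_sum]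
    refine Finset.sum_congr rfl fun j hj => ?_
    have hij : i ≠ j := (Finset.ne_of_mem_erase hj).symm
    have e := chordSq_mul_cot (r := r) (hsin i j hij)
    rw [mul_div_cancel₀ _ (two_ne_zero (α := ℝ))] at e
    rw [if_neg hij]
    linear_combination (m j * pairForce (chordSq r (α j - α i))) * e
  have rad : ∀ (r ω : ℝ) (α : Fin n → ℝ), IsCentralConfiguration m r ω α → ∀ i,
      ∑ j, m j * (if i = j then 0 else
        chordSq r (α j - α i) * pairForce (chordSq r (α j - α i))) = 2 * r ^ 2 * ω := by
    intro r ω α hc i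
    rw [erase_sum _ i (by simp), ← hc.radial i, Finset.mul_sum]
    refine Finset.sum_congr rfl fun j hj => ?_
    rw [if_neg (Finset.ne_of_mem_erase hj).symm]
    nth_rewrite 1 [chordSq]
    ring
  have anti : ∀ (r : ℝ) (α : Fin n → ℝ) i j,
      ((if j = i then 0 else chordSq r (α i - α j) * pairForce (chordSq r (α i - α j)))
        * (Real.cos ((α i - α j) / 2) / Real.sin ((α i - α j) / 2)))
      = -((if i = j then 0 else chordSq r (α j - α i) * pairForce (chordSq r (α j - α i)))
        * (Real.cos ((α j - α i) / 2) / Real.sin ((α j - α i) / 2))) := by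
    intro r α i j
    by_cases hij : i = j
    · simp [hij]
    · rw [if_neg hij, if_neg (Ne.symm hij), show α i - α j = -(α j - α i) by ring]
      simp only [chordSq, Real.cos_neg, neg_div, Real.sin_neg, div_neg]
      ring
  have hs1 : ∀ i j, i ≠ j → Real.sin ((α j - α i) / 2) ≠ 0 := fun i j hij =>
    sin_ne _ ((horder i j hij).imp (fun h => h.1) (fun h => by rw [neg_sub]; exact h.1))
  have hs2 : ∀ i j, i ≠ j → Real.sin ((α' j - α' i) / 2) ≠ 0 := fun i j hij =>
    sin_ne _ ((horder i j hij).imp (fun h => h.2) (fun h => by rw [neg_sub]; exact h.2))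
  -- in the sum over all pairs the angular increments cancel since the tangential forces vanish,
  -- and the radial ones add up to a positive multiple of the quantity in `hsign`
  have hsum : ∑ i, ∑ j, m i * m j * D i j
      = (∑ i, m i) * (2 * ((ω' * r' ^ 2 - ω * r ^ 2) * (Real.log r' - Real.log r))) := by
    have t1 := sum_mul_sub_eq_zero m (fun i j => P i j * κ i j) (anti r α) (tang r ω α h hs1)
      (fun i => (α' i - α i) / 2)
    have t2 := sum_mul_sub_eq_zero m (fun i j => P' i j * κ' i j) (anti r' α')
      (tang r' ω' α' h' hs2) (fun i => (α' i - α i) / 2)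
    have t3 : ∀ i, ∑ j, m i * m j * ((P' i j - P i j) * (Real.log r' - Real.log r))
        = m i * (2 * ((ω' * r' ^ 2 - ω * r ^ 2) * (Real.log r' - Real.log r))) := by
      intro i
      have e1 := rad r ω α h i
      have e2 := rad r' ω' α' h' i
      have : ∑ j, m i * m j * ((P' i j - P i j) * (Real.log r' - Real.log r))
          = m i * (Real.log r' - Real.log r) * (∑ j, m j * P' i j - ∑ j, m j * P i j) := by
        rw [← Finset.sum_sub_distrib, Finset.mul_sum]
        exact Finset.sum_congr rfl fun j _ => by ring
      rw [this, e1, e2]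
      ring
    have split : ∑ i, ∑ j, m i * m j * D i j
        = ∑ i, ∑ j, m i * m j * ((P' i j - P i j) * (Real.log r' - Real.log r))
          + ∑ i, ∑ j, m i * m j * (P' i j * κ' i j * ((α' j - α j) / 2 - (α' i - α i) / 2))
          - ∑ i, ∑ j, m i * m j * (P i j * κ i j * ((α' j - α j) / 2 - (α' i - α i) / 2)) := by
      simp only [← Finset.sum_add_distrib, ← Finset.sum_sub_distrib]
      refine Finset.sum_congr rfl fun i _ => Finset.sum_congr rfl fun j _ => ?_
      simp only [D]
      ring
    rw [split, t1, t2, add_zero, sub_zero, Finset.sum_mul]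
    exact Finset.sum_congr rfl fun i _ => t3 i
  have hsum0 : 0 ≤ ∑ i, ∑ j, m i * m j * D i j := by
    rw [hsum]
    exact mul_nonneg (Finset.sum_nonneg fun i _ => (hm i).le) (by linarith)
  have hle : ∀ i j, m i * m j * D i j ≤ 0 := fun i j =>
    mul_nonpos_of_nonneg_of_nonpos (mul_pos (hm i) (hm j)).le (hDle i j)
  have hD0 : ∀ i j, D i j = 0 := by
    intro i j
    have e1 := (Finset.sum_eq_zero_iff_of_nonpos fun i _ =>
      Finset.sum_nonpos fun j _ => hle i j).1 (le_antisymm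
        (Finset.sum_nonpos fun i _ => Finset.sum_nonpos fun j _ => hle i j) hsum0) i
        (Finset.mem_univ i)
    have e2 := (Finset.sum_eq_zero_iff_of_nonpos fun j _ => hle i j).1 e1 j (Finset.mem_univ j)
    exact (mul_eq_zero.1 e2).resolve_left (mul_pos (hm i) (hm j)).ne'
  have hunch : ∀ i j, i ≠ j → r = r' ∧ α' j - α' i = α j - α i := by
    intro i j hij
    by_contra hcon
    exact (hD i j hij (by tauto)).ne (hD0 i j)
  refine ⟨(hunch ⟨0, by omega⟩ ⟨1, by omega⟩ (by simp)).1.symm, fun i j => ?_⟩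
  by_cases hij : i = j
  · rw [hij]
  · linarith [(hunch i j hij).2]

/-! ### Equally spaced configurations -/

/-- Linear independence of the functions `x ↦ (x + b) ^ (-3 / 2)` on an interval, for terms with
possibly repeated values of `b`: the total coefficient of each value vanishes. All derivatives of
the sum vanish, so the weights annihilate every power, hence every polynomial, in `(x + b)⁻¹`. -/
theorem sum_fiber_eq_zero {ι : Type*} [Fintype ι] (a b : ι → ℝ) {s t : ℝ} (hst : s < t)
    (hb : ∀ j, ∀ x ∈ Set.Ioo s t, 0 < x + b j)
    (h : ∀ x ∈ Set.Ioo s t, ∑ j, a j * (x + b j) ^ (-(3 / 2) : ℝ) = 0) (j₀ : ι) :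
    ∑ j with b j = b j₀, a j = 0 := by
  have hder : ∀ k : ℕ, ∀ x ∈ Set.Ioo s t, ∑ j, a j * (x + b j) ^ (-(3 / 2) - k : ℝ) = 0 := by
    intro k
    induction k with
    | zero => simpa using h
    | succ k ih =>
      intro x hx
      have h1 : HasDerivAt (fun x => ∑ j, a j * (x + b j) ^ (-(3 / 2) - k : ℝ))
          (∑ j, a j * (1 * (-(3 / 2) - k : ℝ) * (x + b j) ^ ((-(3 / 2) - k : ℝ) - 1))) x := by
        refine HasDerivAt.fun_sum fun j _ => HasDerivAt.const_mul _ ?_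
        exact ((hasDerivAt_id x).add_const (b j)).rpow_const (Or.inl (hb j x hx).ne')
      have h2 : HasDerivAt (fun x => ∑ j, a j * (x + b j) ^ (-(3 / 2) - k : ℝ)) 0 x :=
        (hasDerivAt_const x (0 : ℝ)).congr_of_eventuallyEq
          (Filter.eventually_of_mem (Ioo_mem_nhds hx.1 hx.2) ih)
      have h3 := h1.unique h2
      have hk : (-(3 / 2) - k : ℝ) ≠ 0 := by
        have : (0 : ℝ) ≤ k := k.cast_nonneg
        linarith
      refine (mul_eq_zero.1 ?_).resolve_left hk
      rw [← h3, Finset.mul_sum]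
      refine Finset.sum_congr rfl fun j _ => ?_
      rw [show (-(3 / 2) - ((k + 1 : ℕ) : ℝ)) = (-(3 / 2) - k : ℝ) - 1 by push_cast; ring]
      ring
  obtain ⟨x, hx⟩ : (Set.Ioo s t).Nonempty := Set.nonempty_Ioo.2 hst
  have hpos : ∀ j, 0 < x + b j := fun j => hb j x hx
  let c : ι → ℝ := fun j => a j * (x + b j) ^ (-(3 / 2) : ℝ)
  let y : ι → ℝ := fun j => (x + b j)⁻¹
  have hpow : ∀ k : ℕ, ∑ j, c j * y j ^ k = 0 := by
    intro k
    rw [← hder k x hx]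
    refine Finset.sum_congr rfl fun j _ => ?_
    simp only [c, y]
    rw [Real.rpow_sub (hpos j), Real.rpow_natCast, inv_pow, mul_assoc, ← div_eq_mul_inv]
  have hpoly : ∀ p : Polynomial ℝ, ∑ j, c j * p.eval (y j) = 0 := by
    intro p
    simp only [Polynomial.eval_eq_sum_range, Finset.mul_sum]
    rw [Finset.sum_comm]
    refine Finset.sum_eq_zero fun k _ => ?_
    rw [← mul_zero (p.coeff k), ← hpow k, Finset.mul_sum]
    exact Finset.sum_congr rfl fun j _ => by ring
  classical
  -- a polynomial that vanishes at all values of `y` except `y j₀`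
  let Y : Finset ℝ := (Finset.univ.image y).erase (y j₀)
  let p : Polynomial ℝ := ∏ z ∈ Y, (Polynomial.X - Polynomial.C z)
  have hp : ∀ x, p.eval x = ∏ z ∈ Y, (x - z) := by
    intro x; simp [p, Polynomial.eval_prod]
  have hy : ∀ j, y j = y j₀ ↔ b j = b j₀ := by
    intro j
    simp [y]
  have hp0 : p.eval (y j₀) ≠ 0 := by
    rw [hp, Finset.prod_ne_zero_iff]
    intro z hz
    exact sub_ne_zero.2 (Finset.ne_of_mem_erase hz).symm
  have hp1 : ∀ j, b j ≠ b j₀ → p.eval (y j) = 0 := by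
    intro j hj
    rw [hp]
    refine Finset.prod_eq_zero (i := y j) ?_ (sub_self _)
    exact Finset.mem_erase.2 ⟨fun h => hj ((hy j).1 h),
      Finset.mem_image_of_mem y (Finset.mem_univ j)⟩
  have h1 := hpoly p
  rw [← Finset.sum_filter_add_sum_filter_not Finset.univ (fun j => b j = b j₀)] at h1
  rw [Finset.sum_eq_zero (s := Finset.univ.filter fun j => ¬ b j = b j₀) (fun j hj => by
    rw [hp1 j (Finset.mem_filter.1 hj).2, mul_zero]), add_zero] at h1
  have hK : (x + b j₀) ^ (-(3 / 2) : ℝ) * p.eval (y j₀) ≠ 0 :=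
    mul_ne_zero (Real.rpow_pos_of_pos (hpos j₀) _).ne' hp0
  refine (mul_eq_zero.1 ?_).resolve_right hK
  rw [← h1, Finset.sum_mul]
  refine Finset.sum_congr rfl fun j hj => ?_
  have hj := (Finset.mem_filter.1 hj).2
  rw [(hy j).2 hj]
  simp only [c]
  rw [hj]
  ring

/-- A finite configuration on the circle that is symmetric under the reflection in each of its
points is equally spaced: the angles relative to one point, taken modulo `2π`, form the additive
group generated by the least positive one. -/
theorem equally_spaced_of_reflection {n : ℕ} (α : Fin n → ℝ) (i₀ : Fin n)
    (hinj : ∀ i j, ∀ k : ℤ, α j - α i = 2 * Real.pi * k → i = j)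
    (hrefl : ∀ i j, ∃ l, ∃ k : ℤ, α l - α i = -(α j - α i) + 2 * Real.pi * k) :
    ∃ τ : Equiv.Perm (Fin n), ∀ k : Fin n, ∃ l : ℤ,
      α (τ k) = α i₀ + 2 * Real.pi * k / n + 2 * Real.pi * l := by
  have hpi : 0 < 2 * Real.pi := Real.two_pi_pos
  let D : Set ℝ := {x | ∃ j, ∃ k : ℤ, x = α j - α i₀ + 2 * Real.pi * k}
  have hD0 : (0 : ℝ) ∈ D := ⟨i₀, 0, by simp⟩
  have hDrefl : ∀ p ∈ D, ∀ x ∈ D, 2 * p - x ∈ D := by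
    rintro p ⟨i, a, rfl⟩ x ⟨j, b, rfl⟩
    obtain ⟨l, k, hl⟩ := hrefl i j
    refine ⟨l, 2 * a - b - k, ?_⟩
    push_cast
    linear_combination -hl
  have hDneg : ∀ x ∈ D, -x ∈ D := fun x hx => by simpa using hDrefl 0 hD0 x hx
  obtain ⟨j₁, -, hj₁⟩ := Finset.exists_min_image Finset.univ
    (fun j => toIocMod hpi 0 (α j - α i₀)) ⟨i₀, Finset.mem_univ _⟩
  set g := toIocMod hpi 0 (α j₁ - α i₀) with hg
  have hgI := toIocMod_mem_Ioc hpi 0 (α j₁ - α i₀)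
  rw [← hg, zero_add] at hgI
  have hg0 : 0 < g := hgI.1
  have hgD : g ∈ D := by
    refine ⟨j₁, -toIocDiv hpi 0 (α j₁ - α i₀), ?_⟩
    rw [hg, toIocMod, zsmul_eq_mul]
    push_cast
    ring
  have hmin : ∀ x ∈ D, 0 < x → x ≤ g → x = g := by
    rintro x ⟨j, k, hx⟩ h0 h1
    refine le_antisymm h1 ?_
    have h2 := hj₁ j (Finset.mem_univ j)
    have h3 : toIocMod hpi 0 (α j - α i₀) = x := by
      rw [toIocMod_eq_iff]
      refine ⟨⟨h0, by linarith [hgI.2]⟩, -k, ?_⟩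
      rw [zsmul_eq_mul, hx]
      push_cast
      ring
    rwa [h3] at h2
  have hnat : ∀ k : ℕ, (k : ℝ) * g ∈ D ∧ ((k + 1 : ℕ) : ℝ) * g ∈ D := by
    intro k
    induction k with
    | zero => exact ⟨by simpa using hD0, by simpa using hgD⟩
    | succ k ih =>
      refine ⟨ih.2, ?_⟩
      convert hDrefl _ ih.2 _ ih.1 using 1
      push_cast
      ring
  have hint : ∀ z : ℤ, (z : ℝ) * g ∈ D := by
    intro z
    obtain ⟨k, rfl | rfl⟩ := z.eq_nat_or_neg
    · simpa using (hnat k).1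
    · simpa using hDneg _ (hnat k).1
  have hmul : ∀ x ∈ D, ∃ z : ℤ, x = z * g := by
    intro x hx
    -- reflections in `0` and `z * g` compose to the translation by `2 * z * g`, which brings `x`
    -- into `[-g, g]`
    set z := round (x / (2 * g)) with hz
    have h1 : x - 2 * z * g ∈ D := by
      have := hDneg _ (hDrefl _ (hint z) _ hx)
      convert this using 1
      ring
    have h2 : |x - 2 * z * g| ≤ g := by
      have h3 := abs_sub_round (x / (2 * g))
      rw [← hz] at h3
      have h4 : x - 2 * z * g = (x / (2 * g) - z) * (2 * g) := by field_simp
      rw [h4, abs_mul, abs_of_pos (show 0 < 2 * g by linarith)]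
      nlinarith
    rw [abs_le] at h2
    rcases lt_trichotomy (x - 2 * z * g) 0 with h | h | h
    · have := hmin _ (hDneg _ h1) (by linarith) (by linarith)
      refine ⟨2 * z - 1, ?_⟩
      push_cast
      linarith
    · exact ⟨2 * z, by push_cast; linarith⟩
    · have := hmin _ h1 h h2.2
      refine ⟨2 * z + 1, ?_⟩
      push_cast
      linarith
  obtain ⟨N', hN'⟩ := hmul (2 * Real.pi) ⟨i₀, 1, by simp⟩
  have hN'pos : 0 < N' := by
    by_contra hcon
    have : (N' : ℝ) ≤ 0 := by exact_mod_cast not_lt.1 hcon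
    nlinarith
  lift N' to ℕ using hN'pos.le with N
  rw [Int.cast_natCast] at hN'
  have hNpos : 0 < N := by exact_mod_cast hN'pos
  choose f l hfl using fun k : Fin N => hint (k : ℕ)
  have hcong : ∀ z w : ℤ, (∃ l : ℤ, z * g - w * g = 2 * Real.pi * l) → (N : ℤ) ∣ z - w := by
    rintro z w ⟨l, hl⟩
    refine ⟨l, ?_⟩
    rw [hN'] at hl
    have : ((z - w : ℤ) : ℝ) = ((N * l : ℤ) : ℝ) := by
      push_cast
      refine mul_right_cancel₀ hg0.ne' ?_
      linarith
    exact_mod_cast this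
  have hfinj : Function.Injective f := by
    intro k k' hkk
    have h1 := hcong (k : ℕ) (k' : ℕ) ⟨l k - l k', by
      rw [hfl, hfl, hkk]; push_cast; ring⟩
    have h2 : ((k : ℕ) : ℤ) - (k' : ℕ) = 0 :=
      Int.eq_zero_of_abs_lt_dvd h1 (by rw [abs_lt]; omega)
    exact Fin.ext (by omega)
  have hfsurj : Function.Surjective f := by
    intro j
    obtain ⟨z, hz⟩ := hmul (α j - α i₀) ⟨j, 0, by simp⟩
    have hz0 := Int.emod_nonneg z (show (N : ℤ) ≠ 0 by omega)
    have hz1 := Int.emod_lt_of_pos z (show 0 < (N : ℤ) by omega)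
    refine ⟨⟨(z % N).toNat, by omega⟩, ?_⟩
    have h1 := hfl ⟨(z % N).toNat, by omega⟩
    have h2 : (((z % N).toNat : ℤ)) = z % N := Int.toNat_of_nonneg hz0
    simp only [h2] at h1
    refine hinj _ _ (z / N + l ⟨(z % N).toNat, by omega⟩) ?_
    have h3 : ((z % N : ℤ) : ℝ) = z - N * (z / N : ℤ) := by
      have := Int.emod_add_mul_ediv z N
      have : ((z % N + N * (z / N) : ℤ) : ℝ) = z := by exact_mod_cast this
      push_cast at this
      linarith
    rw [h3] at h1
    push_cast
    linear_combination hz + h1 - ((z / N : ℤ) : ℝ) * hN'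
  have hcard : N = n := by
    simpa using Fintype.card_of_bijective ⟨hfinj, hfsurj⟩
  subst hcard
  have hf : Function.Bijective f := ⟨hfinj, hfsurj⟩
  refine ⟨Equiv.ofBijective f hf, fun k => ⟨-l k, ?_⟩⟩
  have h1 := hfl k
  have h2 : g = 2 * Real.pi / N := by rw [hN']; field_simp
  rw [h2] at h1
  rw [Equiv.ofBijective_apply]
  push_cast at h1 ⊢
  linear_combination -h1

/-- If for a whole interval of radii the tangential forces on a configuration of points on a circle
balance, the configuration is symmetric under the reflection in each of its points. -/
theorem reflection_of_tangential {n : ℕ} {m : Fin n → ℝ} (hm : ∀ i, 0 < m i) (α : Fin n → ℝ)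
    (hinj : ∀ i j, ∀ k : ℤ, α j - α i = 2 * Real.pi * k → i = j) {s t : ℝ} (hs : 0 ≤ s)
    (hst : s < t)
    (h : ∀ r, 0 < r → r ^ 2 ∈ Set.Ioo s t → ∀ i, ∑ j ∈ Finset.univ.erase i,
      m j * pairForce (chordSq r (α j - α i)) * Real.sin (α j - α i) = 0) (i j : Fin n) :
    ∃ l, ∃ k : ℤ, α l - α i = -(α j - α i) + 2 * Real.pi * k := by
  by_cases hij : j = i
  · subst hij; exact ⟨j, 0, by simp⟩
  have hcos : ∀ l, l ≠ i → 0 < 1 - Real.cos (α l - α i) := by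
    intro l hl
    refine sub_pos.2 (lt_of_le_of_ne (Real.cos_le_one _) fun h1 => ?_)
    obtain ⟨k, hk⟩ := (Real.cos_eq_one_iff _).1 h1
    exact hl (hinj i l k (by rw [← hk]; ring)).symm
  let ι := {l : Fin n // l ≠ i}
  let σ : ι → ℝ := fun l => 1 - Real.cos (α l - α i)
  have hσ : ∀ l, 0 < σ l := fun l => hcos l l.2
  -- the force of mass `l` as a function of `x = r ^ 2` is `a l * (x + 2 / σ l) ^ (-3 / 2)`, up to
  -- the common factor `x ^ (-3 / 2)`
  let a : ι → ℝ := fun l => m l * Real.sin (α l - α i) / σ l ^ 3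
  have hsum : ∀ x ∈ Set.Ioo s t, ∑ l, a l * (x + 2 / σ l) ^ (-(3 / 2) : ℝ) = 0 := by
    intro x hx
    have hx0 : 0 < x := lt_of_le_of_lt hs hx.1
    have h1 := h (√x) (Real.sqrt_pos.2 hx0) (by rwa [Real.sq_sqrt hx0.le]) i
    have h2 : ∑ l : ι, m l * pairForce (chordSq (√x) (α l - α i)) * Real.sin (α l - α i) = 0 := by
      rw [← h1]
      exact (Finset.sum_subtype (Finset.univ.erase i) (by simp)
        (fun l => m l * pairForce (chordSq (√x) (α l - α i)) * Real.sin (α l - α i))).symm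
    have hx32 : x ^ (3 / 2 : ℝ) ≠ 0 := (Real.rpow_pos_of_pos hx0 _).ne'
    refine (mul_eq_zero.1 ?_).resolve_left (inv_ne_zero hx32)
    rw [← h2, Finset.mul_sum]
    refine Finset.sum_congr rfl fun l _ => ?_
    have hl := hσ l
    have e1 : chordSq (√x) (α l - α i) * (1 + chordSq (√x) (α l - α i) / 4)
        = x * (x + 2 / σ l) * σ l ^ 2 := by
      have : chordSq (√x) (α l - α i) = 2 * x * σ l := by
        unfold chordSq; rw [Real.sq_sqrt hx0.le]
      rw [this]
      field_simp
      ring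
    have hb : 0 < x + 2 / σ l := by positivity
    have e2 : (σ l ^ 2) ^ (3 / 2 : ℝ) = σ l ^ 3 := by
      rw [← Real.rpow_natCast, ← Real.rpow_mul hl.le, ← Real.rpow_natCast]
      norm_num
    unfold pairForce
    rw [e1, Real.mul_rpow (by positivity) (by positivity), Real.mul_rpow hx0.le hb.le, e2,
      Real.rpow_neg hb.le]
    simp only [a]
    have := (Real.rpow_pos_of_pos hb (3 / 2)).ne'
    field_simp
  have hfib := sum_fiber_eq_zero a (fun l => 2 / σ l) hst
    (fun l x hx => by
      have := hσ l
      have : 0 < x := lt_of_le_of_lt hs hx.1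
      positivity) hsum ⟨j, hij⟩
  by_contra hcon
  push Not at hcon
  -- without the mirror image of `j`, all terms of the fibre have the nonzero sine of `j`
  have hsinj : Real.sin (α j - α i) ≠ 0 := by
    intro h0
    obtain ⟨k, hk⟩ := Real.sin_eq_zero_iff.1 h0
    exact hcon j k (by linear_combination -2 * hk)
  have hsin : ∀ l : ι, 2 / σ l = 2 / σ ⟨j, hij⟩ → Real.sin (α l - α i) = Real.sin (α j - α i) := by
    intro l hl
    have h1 : σ l = σ ⟨j, hij⟩ := by
      have := hσ l
      have := hσ ⟨j, hij⟩
      field_simp at hl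
      linarith
    have h2 : Real.cos (α j - α i) = Real.cos (α l - α i) := by
      simp only [σ] at h1
      linarith
    obtain ⟨k, hk | hk⟩ := Real.cos_eq_cos_iff.1 h2
    · rw [hk, add_comm, show 2 * (k : ℝ) * Real.pi = k * (2 * Real.pi) by ring,
        Real.sin_add_int_mul_two_pi]
    · exact absurd (show α l - α i = -(α j - α i) + 2 * Real.pi * k by rw [hk]; ring)
        (hcon l k)
  have hpos : 0 < ∑ l with 2 / σ l = 2 / σ ⟨j, hij⟩, m l / σ l ^ 3 := by
    refine Finset.sum_pos (fun l _ => div_pos (hm l) (pow_pos (hσ l) 3)) ⟨⟨j, hij⟩, by simp⟩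
  refine mul_ne_zero hsinj hpos.ne' ?_
  rw [← hfib, Finset.mul_sum]
  refine Finset.sum_congr rfl fun l hl => ?_
  simp only [a]
  rw [hsin l (Finset.mem_filter.1 hl).2]
  ring

/-! ### Reduction to a planar motion -/

theorem T_mulVec (a x y : ℝ) :
    T a *ᵥ ![x, y] = ![Real.cos a * x - Real.sin a * y, Real.sin a * x + Real.cos a * y] := by
  ext k
  fin_cases k <;> simp [T] <;> ring

theorem S_mulVec (b x y : ℝ) :
    S b *ᵥ ![x, y] = ![Real.cosh b * x + Real.sinh b * y, Real.sinh b * x + Real.cosh b * y] := by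
  ext k
  fin_cases k <;> simp [S] <;> ring

theorem rotate_eq (a b : ℝ) (p : Fin 4 → ℝ) : rotate a b p =
    ![Real.cos a * p 0 - Real.sin a * p 1, Real.sin a * p 0 + Real.cos a * p 1,
      Real.cosh b * p 2 + Real.sinh b * p 3, Real.sinh b * p 2 + Real.cosh b * p 3] := by
  simp only [rotate, join, T_mulVec, S_mulVec, Matrix.cons_val]

/-- Squared distance of the projections to the plane of the first two coordinates. -/
def planarSq (p p' : Fin 4 → ℝ) : ℝ := (p 0 - p' 0) ^ 2 + (p 1 - p' 1) ^ 2

/-- Two points of the upper sheet of the hyperboloid with a common projection to the last two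
coordinates interact through the planar distance alone. -/
theorem mink_eq_of_coaxial {p p' : Fin 4 → ℝ} (hp : mink p p = -1) (hp' : mink p' p' = -1)
    (h2 : p 2 = p' 2) (h3 : p 3 = p' 3) : mink p p' = -1 - planarSq p p' / 2 := by
  unfold mink planarSq at *
  rw [h2, h3] at hp ⊢
  linear_combination hp / 2 + hp' / 2

/-- The motion `q`, with velocities `v` and accelerations `a`, projects to one common point in the
plane of the last two coordinates, and to a motion under pairwise attraction and a common
central force `κ` on a circle of radius `√(ρ ^ 2 - 1)` in the plane of the first two. -/
structure IsPlanarMotion {n : ℕ} (m : Fin n → ℝ) (I : Set ℝ) (q v a : Fin n → ℝ → Fin 4 → ℝ)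
    (ρ κ : ℝ → ℝ) : Prop where
  card : 3 ≤ n
  nonempty : I.Nonempty
  isOpen : IsOpen I
  isPreconnected : IsPreconnected I
  velocity : ∀ t ∈ I, ∀ i k, HasDerivAt (fun s => q i s k) (v i t k) t
  acceleration : ∀ t ∈ I, ∀ i k, HasDerivAt (fun s => v i s k) (a i t k) t
  coaxial : ∀ t ∈ I, ∀ i j, q i t 2 = q j t 2 ∧ q i t 3 = q j t 3
  upper : ∀ t ∈ I, ∀ i, 0 < q i t 3
  height : ∀ t ∈ I, ∀ i, q i t 3 ^ 2 - q i t 2 ^ 2 = ρ t ^ 2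
  radius : ∀ t ∈ I, ∀ i, q i t 0 ^ 2 + q i t 1 ^ 2 = ρ t ^ 2 - 1
  planarSq_pos : ∀ t ∈ I, ∀ i j, i ≠ j → 0 < planarSq (q i t) (q j t)
  planar : ∀ t ∈ I, ∀ i, ∀ k : Fin 4, k = 0 ∨ k = 1 →
    a i t k = ∑ j ∈ Finset.univ.erase i,
      m j * pairForce (planarSq (q i t) (q j t)) * (q j t k - q i t k) + κ t * q i t k
  axial : ∀ t ∈ I, ∀ i, ∀ k : Fin 4, k = 2 ∨ k = 3 → a i t k = κ t * q i t k

section Coaxial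

variable {n : ℕ} {m : Fin n → ℝ} {I : Set ℝ} {q : Fin n → ℝ → Fin 4 → ℝ} {ρ : ℝ → ℝ}

/-- The boosts `β i` of a solution in hyperbolic form all agree. The quantity `q₃ q̇₄ - q₄ q̇₃` is
the same for all masses, hence so is its derivative, which is a positive combination of the
`sinh (β i - β j)`; comparing the largest and the smallest `β i` forces all terms to vanish. -/
theorem boost_eq (hm : ∀ i, 0 < m i) (hq : IsSolution m I q)
    {φ : ℝ → ℝ} {β : Fin n → ℝ} (hρ : TwiceDifferentiableOn ρ I) (hφ : TwiceDifferentiableOn φ I)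
    (hpos : ∀ t ∈ I, 0 < ρ t)
    (hrad : ∀ t ∈ I, ∀ i, q i t 0 ^ 2 + q i t 1 ^ 2 = ρ t ^ 2 - 1)
    (h2 : ∀ t ∈ I, ∀ i, q i t 2 = ρ t * Real.sinh (φ t + β i))
    (h3 : ∀ t ∈ I, ∀ i, q i t 3 = ρ t * Real.cosh (φ t + β i)) (i j : Fin n) : β i = β j := by
  obtain ⟨v, hv⟩ := hq.motion
  have hvk : ∀ t ∈ I, ∀ i k, HasDerivAt (fun s => q i s k) (v i t k) t :=
    fun t ht i k => hasDerivAt_pi.1 (hv t ht i).1 k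
  have hak : ∀ t ∈ I, ∀ i k, HasDerivAt (fun s => v i s k)
      (acceleration m (fun j => q j t) (fun j => v j t) i k) t :=
    fun t ht i k => hasDerivAt_pi.1 (hv t ht i).2 k
  have hev : ∀ t ∈ I, ∀ᶠ s in nhds t, s ∈ I := fun t ht => hq.isOpen.mem_nhds ht
  have hL : ∀ t ∈ I, ∀ i, q i t 2 * v i t 3 - q i t 3 * v i t 2 = -(ρ t ^ 2 * deriv φ t) := by
    intro t ht i
    have dρ := (hρ t ht).1.hasDerivAt
    have dφ := ((hφ t ht).1.hasDerivAt).add_const (β i)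
    have e2 := (hvk t ht i 2).unique ((dρ.mul dφ.sinh).congr_of_eventuallyEq
      ((hev t ht).mono fun s hs => h2 s hs i))
    have e3 := (hvk t ht i 3).unique ((dρ.mul dφ.cosh).congr_of_eventuallyEq
      ((hev t ht).mono fun s hs => h3 s hs i))
    rw [e2, e3, h2 t ht, h3 t ht]
    linear_combination -(ρ t ^ 2 * deriv φ t) * Real.cosh_sq_sub_sinh_sq (φ t + β i)
  obtain ⟨t, ht⟩ := hq.nonempty
  have hc : ∀ i j, i ≠ j → 0 < mink (q i t) (q j t) ^ 2 - 1 := by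
    intro i j hij
    have hle : mink (q i t) (q j t) ≤ -1 := by
      have e : mink (q i t) (q j t)
          = q i t 0 * q j t 0 + q i t 1 * q j t 1 - ρ t ^ 2 * Real.cosh (β i - β j) := by
        rw [show β i - β j = (φ t + β i) - (φ t + β j) by ring, Real.cosh_sub]
        unfold mink
        rw [h2 t ht, h2 t ht, h3 t ht, h3 t ht]
        ring
      rw [e]
      nlinarith [hrad t ht i, hrad t ht j, Real.one_le_cosh (β i - β j), sq_nonneg (ρ t),
        sq_nonneg (q i t 0 - q j t 0), sq_nonneg (q i t 1 - q j t 1)]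
    have hne := hq.regular t ht i j hij
    have : 0 ≤ mink (q i t) (q j t) ^ 2 - 1 := by nlinarith
    exact lt_of_le_of_ne this fun h => hne (by linarith)
  let W : Fin n → Fin n → ℝ := fun i j =>
    m j / (mink (q i t) (q j t) ^ 2 - 1) ^ (3 / 2 : ℝ) * ρ t ^ 2
  have hW : ∀ i j, i ≠ j → 0 < W i j := fun i j hij =>
    mul_pos (div_pos (hm j) (Real.rpow_pos_of_pos (hc i j hij) _)) (pow_pos (hpos t ht) 2)
  let F : Fin n → ℝ := fun i => ∑ j ∈ Finset.univ.erase i, W i j * Real.sinh (β i - β j)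
  have hF : ∀ i, HasDerivAt (fun s => -(ρ s ^ 2 * deriv φ s)) (F i) t := by
    intro i
    have h := (((hvk t ht i 2).mul (hak t ht i 3)).sub ((hvk t ht i 3).mul (hak t ht i 2)))
    have h' := h.congr_of_eventuallyEq
      ((hev t ht).mono fun s hs => (hL s hs i).symm)
    refine h'.congr_deriv ?_
    have e : ∀ k, acceleration m (fun j => q j t) (fun j => v j t) i k
        = ∑ j ∈ Finset.univ.erase i, m j / (mink (q i t) (q j t) ^ 2 - 1) ^ (3 / 2 : ℝ)
          * (q j t k + mink (q i t) (q j t) * q i t k) + mink (v i t) (v i t) * q i t k := by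
      intro k
      simp only [acceleration, Pi.add_apply, Finset.sum_apply, Pi.smul_apply, smul_eq_mul]
    have e4 : F i = q i t 2 * ∑ j ∈ Finset.univ.erase i,
          m j / (mink (q i t) (q j t) ^ 2 - 1) ^ (3 / 2 : ℝ)
            * (q j t 3 + mink (q i t) (q j t) * q i t 3)
        - q i t 3 * ∑ j ∈ Finset.univ.erase i,
          m j / (mink (q i t) (q j t) ^ 2 - 1) ^ (3 / 2 : ℝ)
            * (q j t 2 + mink (q i t) (q j t) * q i t 2) := by
      rw [Finset.mul_sum, Finset.mul_sum, ← Finset.sum_sub_distrib]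
      refine Finset.sum_congr rfl fun j _ => ?_
      simp only [W]
      rw [show β i - β j = (φ t + β i) - (φ t + β j) by ring, Real.sinh_sub,
        h2 t ht, h2 t ht, h3 t ht, h3 t ht]
      ring
    rw [e, e, e4]
    ring
  have hFeq : ∀ i j, F i = F j := fun i j => (hF i).unique (hF j)
  obtain ⟨a, -, ha⟩ := Finset.exists_max_image Finset.univ β ⟨i, Finset.mem_univ _⟩
  obtain ⟨b, -, hb⟩ := Finset.exists_min_image Finset.univ β ⟨i, Finset.mem_univ _⟩
  have hterm : ∀ j ∈ Finset.univ.erase a, 0 ≤ W a j * Real.sinh (β a - β j) := fun j hj =>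
    mul_nonneg (hW a j (Finset.ne_of_mem_erase hj).symm).le
      (Real.sinh_nonneg_iff.2 (sub_nonneg.2 (ha j (Finset.mem_univ j))))
  have hFa : F a = 0 := by
    refine le_antisymm ?_ (Finset.sum_nonneg hterm)
    rw [hFeq a b]
    exact Finset.sum_nonpos fun j hj =>
      mul_nonpos_of_nonneg_of_nonpos (hW b j (Finset.ne_of_mem_erase hj).symm).le
        (Real.sinh_nonpos_iff.2 (sub_nonpos.2 (hb j (Finset.mem_univ j))))
  have hall : ∀ j, β j = β a := by
    intro j
    by_cases hj : j = a
    · rw [hj]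
    · have hz := (Finset.sum_eq_zero_iff_of_nonneg hterm).1 hFa j (by simp [hj])
      have := (mul_eq_zero.1 hz).resolve_left (hW a j (Ne.symm hj)).ne'
      linarith [Real.sinh_eq_zero.1 this]
  rw [hall i, hall j]

/-- A solution in hyperbolic form reduces to a planar motion. -/
theorem exists_isPlanarMotion (hm : ∀ i, 0 < m i) (hq : IsSolution m I q)
    (hform : ∃ x y : Fin n → ℝ → ℝ, HyperbolicForm I q ρ x y)
    (hpoly : ∀ t ∈ I, IsPolygon (fun i => q i t)) :
    ∃ v a κ, IsPlanarMotion m I q v a ρ κ := by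
  obtain ⟨x, y, hρ, hρ0, -, hxy, φ, β, hφ, hqf⟩ := hform
  obtain ⟨t₀, ht₀⟩ := hq.nonempty
  have hn : 3 ≤ n := (hpoly t₀ ht₀).1
  have i₀ : Fin n := ⟨0, by omega⟩
  have hpos : ∀ t ∈ I, 0 < ρ t := by
    intro t ht
    refine lt_of_le_of_ne (hρ0 t ht) fun h => ?_
    have := hxy i₀ t ht
    rw [← h] at this
    nlinarith [sq_nonneg (x i₀ t), sq_nonneg (y i₀ t)]
  have hrad : ∀ t ∈ I, ∀ i, q i t 0 ^ 2 + q i t 1 ^ 2 = ρ t ^ 2 - 1 := by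
    intro t ht i
    have : q i t 0 = x i t ∧ q i t 1 = y i t := by rw [hqf i t ht]; simp [join]
    rw [this.1, this.2]
    linarith [hxy i t ht]
  have h2 : ∀ t ∈ I, ∀ i, q i t 2 = ρ t * Real.sinh (φ t + β i) := by
    intro t ht i
    rw [hqf i t ht, Real.sinh_add]
    simp only [S_mulVec, join, Matrix.cons_val, Pi.smul_apply, smul_eq_mul]
    ring
  have h3 : ∀ t ∈ I, ∀ i, q i t 3 = ρ t * Real.cosh (φ t + β i) := by
    intro t ht i
    rw [hqf i t ht, Real.cosh_add]
    simp only [S_mulVec, join, Matrix.cons_val, Pi.smul_apply, smul_eq_mul]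
    ring
  have hβ := boost_eq hm hq hρ hφ hpos hrad h2 h3
  have hco : ∀ t ∈ I, ∀ i j, q i t 2 = q j t 2 ∧ q i t 3 = q j t 3 := by
    intro t ht i j
    rw [h2 t ht, h2 t ht, h3 t ht, h3 t ht, hβ i j]
    exact ⟨rfl, rfl⟩
  have hup : ∀ t ∈ I, ∀ i, 0 < q i t 3 := by
    intro t ht i
    rw [h3 t ht]
    exact mul_pos (hpos t ht) (Real.cosh_pos _)
  obtain ⟨v, hv⟩ := hq.motion
  have hvk : ∀ t ∈ I, ∀ i k, HasDerivAt (fun s => q i s k) (v i t k) t :=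
    fun t ht i k => hasDerivAt_pi.1 (hv t ht i).1 k
  have hak : ∀ t ∈ I, ∀ i k, HasDerivAt (fun s => v i s k)
      (acceleration m (fun j => q j t) (fun j => v j t) i k) t :=
    fun t ht i k => hasDerivAt_pi.1 (hv t ht i).2 k
  have hev : ∀ t ∈ I, ∀ᶠ s in nhds t, s ∈ I := fun t ht => hq.isOpen.mem_nhds ht
  let κ : Fin n → ℝ → ℝ := fun i t => ∑ j ∈ Finset.univ.erase i,
      m j * pairForce (planarSq (q i t) (q j t)) * (1 + mink (q i t) (q j t)) + mink (v i t) (v i t)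
  have hacc : ∀ t ∈ I, ∀ i k, acceleration m (fun j => q j t) (fun j => v j t) i k
      = ∑ j ∈ Finset.univ.erase i,
        m j * pairForce (planarSq (q i t) (q j t)) * (q j t k - q i t k) + κ i t * q i t k := by
    intro t ht i k
    have hc : ∀ j, mink (q i t) (q j t) ^ 2 - 1
        = planarSq (q i t) (q j t) * (1 + planarSq (q i t) (q j t) / 4) := by
      intro j
      rw [mink_eq_of_coaxial (hq.mem_hyperboloid i t ht) (hq.mem_hyperboloid j t ht)
        (hco t ht i j).1 (hco t ht i j).2]
      ring
    simp only [acceleration, κ, Pi.add_apply, Finset.sum_apply, Pi.smul_apply, smul_eq_mul, hc]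
    rw [add_mul, ← add_assoc, Finset.sum_mul, ← Finset.sum_add_distrib]
    congr 1
    refine Finset.sum_congr rfl fun j _ => ?_
    unfold pairForce
    ring
  have hax : ∀ t ∈ I, ∀ i, ∀ k : Fin 4, k = 2 ∨ k = 3 →
      acceleration m (fun j => q j t) (fun j => v j t) i k = κ i t * q i t k := by
    intro t ht i k hk
    rw [hacc t ht, Finset.sum_eq_zero, zero_add]
    intro j _
    have : q j t k = q i t k := by
      rcases hk with rfl | rfl
      · exact (hco t ht j i).1
      · exact (hco t ht j i).2
    rw [this, sub_self, mul_zero]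
  have hv3 : ∀ t ∈ I, ∀ i, v i t 3 = v i₀ t 3 := fun t ht i =>
    (hvk t ht i 3).unique ((hvk t ht i₀ 3).congr_of_eventuallyEq
      ((hev t ht).mono fun s hs => (hco s hs i i₀).2))
  have hκ : ∀ t ∈ I, ∀ i, κ i t = κ i₀ t := by
    intro t ht i
    have h := (hak t ht i 3).unique ((hak t ht i₀ 3).congr_of_eventuallyEq
      ((hev t ht).mono fun s hs => hv3 s hs i))
    rw [hax t ht i 3 (Or.inr rfl), hax t ht i₀ 3 (Or.inr rfl), (hco t ht i i₀).2] at h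
    exact mul_right_cancel₀ (hup t ht i₀).ne' h
  refine ⟨v, fun i t => acceleration m (fun j => q j t) (fun j => v j t) i, κ i₀, hn, hq.nonempty,
    hq.isOpen, hq.ordConnected.isPreconnected, hvk, hak, hco, hup, ?_, hrad, ?_, ?_, ?_⟩
  · intro t ht i
    rw [h2 t ht, h3 t ht]
    linear_combination ρ t ^ 2 * Real.cosh_sq_sub_sinh_sq (φ t + β i)
  · intro t ht i j hij
    by_contra hcon
    have h0 : planarSq (q i t) (q j t) = 0 :=
      le_antisymm (not_lt.1 hcon) (add_nonneg (sq_nonneg _) (sq_nonneg _))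
    refine hq.regular t ht i j hij ?_
    rw [mink_eq_of_coaxial (hq.mem_hyperboloid i t ht) (hq.mem_hyperboloid j t ht)
        (hco t ht i j).1 (hco t ht i j).2, h0]
    norm_num
  · intro t ht i k _
    rw [hacc t ht, hκ t ht]
  · intro t ht i k hk
    rw [hax t ht i k hk, hκ t ht]

end Coaxial

/-! ### Rigid planar motions -/

/-- The projection of the configuration to the plane of the first two coordinates keeps its shape:
up to a rotation `ψ` that depends on time, it lies at the fixed angles `α i`. -/
def IsRigid {n : ℕ} (I : Set ℝ) (q : Fin n → ℝ → Fin 4 → ℝ) (ρ : ℝ → ℝ) (α : Fin n → ℝ) : Prop :=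
  ∀ t ∈ I, ∃ ψ : ℝ, ∀ i, q i t 0 = √(ρ t ^ 2 - 1) * Real.sin (ψ + α i) ∧
    q i t 1 = √(ρ t ^ 2 - 1) * Real.cos (ψ + α i)

theorem exists_angle {x y r : ℝ} (hr : 0 < r) (h : x ^ 2 + y ^ 2 = r ^ 2) :
    ∃ α ∈ Set.Ico 0 (2 * Real.pi), x = r * Real.sin α ∧ y = r * Real.cos α := by
  let z : ℂ := ⟨y, x⟩
  have hz : ‖z‖ = r := by
    rw [Complex.norm_def, Complex.normSq_mk, show y * y + x * x = r ^ 2 by linarith,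
      Real.sqrt_sq hr.le]
  have hx := Complex.norm_mul_sin_arg z
  have hy := Complex.norm_mul_cos_arg z
  rw [hz] at hx hy
  have hm := toIcoMod_mem_Ico Real.two_pi_pos 0 z.arg
  rw [zero_add] at hm
  refine ⟨_, hm, ?_, ?_⟩
  · rw [toIcoMod, zsmul_eq_mul, Real.sin_sub_int_mul_two_pi]; exact hx.symm
  · rw [toIcoMod, zsmul_eq_mul, Real.cos_sub_int_mul_two_pi]; exact hy.symm

/-- The circumradius of a triangle in terms of its squared side lengths `a`, `b`, `c`. -/
theorem circumradius_identity {x₀ y₀ x₁ y₁ x₂ y₂ R a b c : ℝ}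
    (h₀ : x₀ ^ 2 + y₀ ^ 2 = R) (h₁ : x₁ ^ 2 + y₁ ^ 2 = R) (h₂ : x₂ ^ 2 + y₂ ^ 2 = R)
    (ha : (x₀ - x₁) ^ 2 + (y₀ - y₁) ^ 2 = a) (hb : (x₁ - x₂) ^ 2 + (y₁ - y₂) ^ 2 = b)
    (hc : (x₀ - x₂) ^ 2 + (y₀ - y₂) ^ 2 = c) :
    a * b * c = R * (2 * a * b + 2 * b * c + 2 * a * c - a ^ 2 - b ^ 2 - c ^ 2) := by
  -- the Gram determinant of three planar vectors vanishes
  have gram : (x₀ ^ 2 + y₀ ^ 2) * (x₁ ^ 2 + y₁ ^ 2) * (x₂ ^ 2 + y₂ ^ 2)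
      + 2 * (x₀ * x₁ + y₀ * y₁) * (x₁ * x₂ + y₁ * y₂) * (x₀ * x₂ + y₀ * y₂)
      - (x₀ ^ 2 + y₀ ^ 2) * (x₁ * x₂ + y₁ * y₂) ^ 2 - (x₁ ^ 2 + y₁ ^ 2) * (x₀ * x₂ + y₀ * y₂) ^ 2
      - (x₂ ^ 2 + y₂ ^ 2) * (x₀ * x₁ + y₀ * y₁) ^ 2 = 0 := by ring
  rw [h₀, h₁, h₂] at gram
  have ea : a = 2 * (R - (x₀ * x₁ + y₀ * y₁)) := by linear_combination h₀ + h₁ - ha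
  have eb : b = 2 * (R - (x₁ * x₂ + y₁ * y₂)) := by linear_combination h₁ + h₂ - hb
  have ec : c = 2 * (R - (x₀ * x₂ + y₀ * y₂)) := by linear_combination h₀ + h₂ - hc
  rw [ea, eb, ec]
  linear_combination -4 * gram

namespace IsPlanarMotion

variable {n : ℕ} {m : Fin n → ℝ} {I : Set ℝ} {q v a : Fin n → ℝ → Fin 4 → ℝ} {ρ κ : ℝ → ℝ}

theorem eventually_mem (h : IsPlanarMotion m I q v a ρ κ) {t : ℝ} (ht : t ∈ I) :
    ∀ᶠ s in nhds t, s ∈ I := h.isOpen.mem_nhds ht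

theorem radius_pos (h : IsPlanarMotion m I q v a ρ κ) {t : ℝ} (ht : t ∈ I) : 0 < ρ t ^ 2 - 1 := by
  have hn := h.card
  have h0 := h.radius t ht ⟨0, by omega⟩
  have h1 := h.radius t ht ⟨1, by omega⟩
  have h2 := h.planarSq_pos t ht ⟨0, by omega⟩ ⟨1, by omega⟩ (by simp)
  refine lt_of_le_of_ne (h0 ▸ add_nonneg (sq_nonneg _) (sq_nonneg _)) fun hz => ?_
  unfold planarSq at h2
  nlinarith [sq_nonneg (q ⟨0, by omega⟩ t 0 + q ⟨1, by omega⟩ t 0),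
    sq_nonneg (q ⟨0, by omega⟩ t 1 + q ⟨1, by omega⟩ t 1)]

theorem sq_sqrt_radius (h : IsPlanarMotion m I q v a ρ κ) {t : ℝ} (ht : t ∈ I) :
    √(ρ t ^ 2 - 1) ^ 2 = ρ t ^ 2 - 1 := Real.sq_sqrt (h.radius_pos ht).le

/-- A planar motion of constant shape is rigid: the size of an inscribed triangle determines the
radius of the circle, so the angular distances are constant up to sign, and the sign is constant by
continuity. -/
theorem isRigid_of_sameShape (h : IsPlanarMotion m I q v a ρ κ)
    (hshape : ∀ s ∈ I, ∀ t ∈ I, SameShape (fun i => q i s) (fun i => q i t)) :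
    ∃ α, IsRigid I q ρ α := by
  have hn := h.card
  obtain ⟨s, hs⟩ := h.nonempty
  let i₀ : Fin n := ⟨0, by omega⟩
  let i₁ : Fin n := ⟨1, by omega⟩
  let i₂ : Fin n := ⟨2, by omega⟩
  have h01 : i₀ ≠ i₁ := by simp [i₀, i₁]
  have h12 : i₁ ≠ i₂ := by simp [i₁, i₂]
  have h02 : i₀ ≠ i₂ := by simp [i₀, i₂]
  have hR : ∀ t ∈ I, 0 < ρ t ^ 2 - 1 := fun t ht => h.radius_pos ht
  have hscale : ∀ t ∈ I, ∀ i j, planarSq (q i t) (q j t) * (ρ s ^ 2 - 1)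
      = planarSq (q i s) (q j s) * (ρ t ^ 2 - 1) := by
    intro t ht
    obtain ⟨c, hc, hE⟩ := hshape s hs t ht
    have hE' : ∀ i j, planarSq (q i t) (q j t) = c * planarSq (q i s) (q j s) := by
      intro i j
      have := hE i j
      simp only [mink, Pi.sub_apply, (h.coaxial t ht i j).1, (h.coaxial t ht i j).2,
        (h.coaxial s hs i j).1, (h.coaxial s hs i j).2] at this
      unfold planarSq
      linear_combination this
    have es := circumradius_identity (h.radius s hs i₀) (h.radius s hs i₁) (h.radius s hs i₂)
      rfl rfl rfl
    have et := circumradius_identity (h.radius t ht i₀) (h.radius t ht i₁) (h.radius t ht i₂)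
      (hE' i₀ i₁) (hE' i₁ i₂) (hE' i₀ i₂)
    change planarSq (q i₀ s) (q i₁ s) * planarSq (q i₁ s) (q i₂ s) * planarSq (q i₀ s) (q i₂ s)
      = (ρ s ^ 2 - 1) * (2 * planarSq (q i₀ s) (q i₁ s) * planarSq (q i₁ s) (q i₂ s)
        + 2 * planarSq (q i₁ s) (q i₂ s) * planarSq (q i₀ s) (q i₂ s)
        + 2 * planarSq (q i₀ s) (q i₁ s) * planarSq (q i₀ s) (q i₂ s)
        - planarSq (q i₀ s) (q i₁ s) ^ 2 - planarSq (q i₁ s) (q i₂ s) ^ 2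
        - planarSq (q i₀ s) (q i₂ s) ^ 2) at es
    have hP := mul_pos (mul_pos (h.planarSq_pos s hs i₀ i₁ h01) (h.planarSq_pos s hs i₁ i₂ h12))
      (h.planarSq_pos s hs i₀ i₂ h02)
    -- the identity is homogeneous in the squared lengths, so the radius scales with the sides
    have hRc : ρ t ^ 2 - 1 = c * (ρ s ^ 2 - 1) := by
      refine mul_right_cancel₀ (mul_pos (pow_pos hc 2) hP).ne' ?_
      linear_combination c ^ 2 * (ρ t ^ 2 - 1) * es - (ρ s ^ 2 - 1) * et
    intro i j
    rw [hE', hRc]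
    ring
  have hdot : ∀ t ∈ I, ∀ i, (q i₀ t 0 * q i t 0 + q i₀ t 1 * q i t 1) * (ρ s ^ 2 - 1)
      = (q i₀ s 0 * q i s 0 + q i₀ s 1 * q i s 1) * (ρ t ^ 2 - 1) := by
    intro t ht i
    have := hscale t ht i₀ i
    unfold planarSq at this
    linear_combination -this / 2 + (ρ s ^ 2 - 1) / 2 * (h.radius t ht i₀ + h.radius t ht i)
      - (ρ t ^ 2 - 1) / 2 * (h.radius s hs i₀ + h.radius s hs i)
  have hcross : ∀ i, ∀ t ∈ I, (q i₀ t 0 * q i t 1 - q i₀ t 1 * q i t 0) * (ρ s ^ 2 - 1)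
      = (q i₀ s 0 * q i s 1 - q i₀ s 1 * q i s 0) * (ρ t ^ 2 - 1) := by
    intro i
    let X : ℝ → ℝ := fun t => (q i₀ t 0 * q i t 1 - q i₀ t 1 * q i t 0)
    let R : ℝ → ℝ := fun t => q i₀ t 0 ^ 2 + q i₀ t 1 ^ 2
    have hcont : ∀ i k, ContinuousOn (fun t => q i t k) I := fun i k t ht =>
      (h.velocity t ht i k).continuousAt.continuousWithinAt
    have hX : ContinuousOn X I := ((hcont i₀ 0).mul (hcont i 1)).sub ((hcont i₀ 1).mul (hcont i 0))
    have hRc : ContinuousOn R I := ((hcont i₀ 0).pow 2).add ((hcont i₀ 1).pow 2)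
    have hsq : ∀ t ∈ I, (X t * (ρ s ^ 2 - 1)) ^ 2 = (X s * (ρ t ^ 2 - 1)) ^ 2 := by
      intro t ht
      -- Lagrange's identity expresses the square of the cross product by the dot product
      have l : ∀ t ∈ I, X t ^ 2
          = (ρ t ^ 2 - 1) ^ 2 - (q i₀ t 0 * q i t 0 + q i₀ t 1 * q i t 1) ^ 2 := by
        intro t ht
        rw [sq (ρ t ^ 2 - 1)]
        nth_rewrite 1 [← h.radius t ht i₀]
        rw [← h.radius t ht i]
        simp only [X]
        ring
      rw [mul_pow, mul_pow, l t ht, l s hs]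
      linear_combination -((q i₀ t 0 * q i t 0 + q i₀ t 1 * q i t 1) * (ρ s ^ 2 - 1)
        + (q i₀ s 0 * q i s 0 + q i₀ s 1 * q i s 1) * (ρ t ^ 2 - 1)) * hdot t ht i
    by_cases hX0 : X s = 0
    · intro t ht
      have := hsq t ht
      rw [hX0, zero_mul, zero_pow two_ne_zero] at this
      have : X t * (ρ s ^ 2 - 1) = 0 := by simpa using this
      change X t * _ = X s * _
      rw [hX0, zero_mul, this]
    · have hR' : ∀ t ∈ I, R t = ρ t ^ 2 - 1 := fun t ht => h.radius t ht i₀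
      have := h.isPreconnected.eq_or_eq_neg_of_sq_eq (f := fun t => X t * (ρ s ^ 2 - 1))
        (g := fun t => X s * R t) (hX.mul continuousOn_const) (continuousOn_const.mul hRc)
        (fun t ht => by
          simp only [Pi.pow_apply]
          rw [hR' t ht, hsq t ht])
        (fun {t} ht => mul_ne_zero hX0 (by rw [hR' t ht]; exact (hR t ht).ne'))
      rcases this with h1 | h1
      · intro t ht
        have := h1 ht
        simp only at this
        rwa [hR' t ht] at this
      · exfalso
        have := h1 hs
        simp only [Pi.neg_apply] at this
        rw [hR' s hs] at this
        have h3 := mul_ne_zero hX0 (hR s hs).ne'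
        exact h3 (by linarith)
  choose α hα0 hα using fun i => exists_angle (Real.sqrt_pos.2 (hR s hs))
    ((h.radius s hs i).trans (h.sq_sqrt_radius hs).symm)
  refine ⟨α, fun t ht => ?_⟩
  obtain ⟨ψ, -, hψ0, hψ1⟩ := exists_angle (Real.sqrt_pos.2 (hR t ht))
    ((h.radius t ht i₀).trans (h.sq_sqrt_radius ht).symm)
  refine ⟨ψ - α i₀, fun i => ?_⟩
  set r := √(ρ t ^ 2 - 1) with hr
  set r' := √(ρ s ^ 2 - 1) with hr'
  have hr0 : 0 < r := Real.sqrt_pos.2 (hR t ht)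
  have hr0' : 0 < r' := Real.sqrt_pos.2 (hR s hs)
  have e1 := hdot t ht i
  have e2 := hcross i t ht
  rw [← h.sq_sqrt_radius ht, ← h.sq_sqrt_radius hs, hψ0, hψ1, (hα i₀).1, (hα i₀).2, (hα i).1,
    (hα i).2, ← hr, ← hr'] at e1 e2
  have e1' : Real.sin ψ * q i t 0 + Real.cos ψ * q i t 1
      = r * (Real.sin (α i₀) * Real.sin (α i) + Real.cos (α i₀) * Real.cos (α i)) :=
    mul_left_cancel₀ (mul_pos hr0 (pow_pos hr0' 2)).ne' (by linear_combination e1)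
  have e2' : Real.sin ψ * q i t 1 - Real.cos ψ * q i t 0
      = r * (Real.sin (α i₀) * Real.cos (α i) - Real.cos (α i₀) * Real.sin (α i)) :=
    mul_left_cancel₀ (mul_pos hr0 (pow_pos hr0' 2)).ne' (by linear_combination e2)
  have e3 := Real.sin_sq_add_cos_sq ψ
  rw [show ψ - α i₀ + α i = ψ + (α i - α i₀) by ring, Real.sin_add, Real.cos_add, Real.sin_sub,
    Real.cos_sub]
  constructor
  · linear_combination Real.sin ψ * e1' - Real.cos ψ * e2' - q i t 0 * e3
  · linear_combination Real.cos ψ * e1' + Real.sin ψ * e2' - q i t 1 * e3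

/-- In a rigid planar motion all masses have the same angular momentum per unit mass, which is
constant, and the tangential forces balance. -/
theorem tangential (h : IsPlanarMotion m I q v a ρ κ) (hm : ∀ i, 0 < m i) {α : Fin n → ℝ}
    (hα : IsRigid I q ρ α) {t : ℝ} (ht : t ∈ I) :
    (∀ i, ∑ j ∈ Finset.univ.erase i, m j * pairForce (chordSq (√(ρ t ^ 2 - 1)) (α j - α i))
      * Real.sin (α j - α i) = 0) ∧
    (∀ i j, q i t 0 * v i t 1 - q i t 1 * v i t 0 = q j t 0 * v j t 1 - q j t 1 * v j t 0) ∧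
    ∀ i, HasDerivAt (fun s => q i s 0 * v i s 1 - q i s 1 * v i s 0) 0 t := by
  have hn := h.card
  have hrot : ∀ s ∈ I, ∀ i j,
      q j s 0 = Real.cos (α j - α i) * q i s 0 + Real.sin (α j - α i) * q i s 1 ∧
      q j s 1 = Real.cos (α j - α i) * q i s 1 - Real.sin (α j - α i) * q i s 0 := by
    intro s hs i j
    obtain ⟨ψ, hψ⟩ := hα s hs
    rw [(hψ i).1, (hψ i).2, (hψ j).1, (hψ j).2, show ψ + α j = (ψ + α i) + (α j - α i) by ring,
      Real.sin_add (ψ + α i), Real.cos_add (ψ + α i)]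
    constructor <;> ring
  have hvrot : ∀ s ∈ I, ∀ i j,
      v j s 0 = Real.cos (α j - α i) * v i s 0 + Real.sin (α j - α i) * v i s 1 ∧
      v j s 1 = Real.cos (α j - α i) * v i s 1 - Real.sin (α j - α i) * v i s 0 := by
    intro s hs i j
    exact ⟨(h.velocity s hs j 0).unique ((((h.velocity s hs i 0).const_mul _).add
        ((h.velocity s hs i 1).const_mul _)).congr_of_eventuallyEq
          ((h.eventually_mem hs).mono fun s hs => (hrot s hs i j).1)),
      (h.velocity s hs j 1).unique ((((h.velocity s hs i 1).const_mul _).sub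
        ((h.velocity s hs i 0).const_mul _)).congr_of_eventuallyEq
          ((h.eventually_mem hs).mono fun s hs => (hrot s hs i j).2))⟩
  have hang : ∀ s ∈ I, ∀ i j,
      q i s 0 * v i s 1 - q i s 1 * v i s 0 = q j s 0 * v j s 1 - q j s 1 * v j s 0 := by
    intro s hs i j
    rw [(hrot s hs i j).1, (hrot s hs i j).2, (hvrot s hs i j).1, (hvrot s hs i j).2]
    linear_combination -(q i s 0 * v i s 1 - q i s 1 * v i s 0)
      * Real.sin_sq_add_cos_sq (α j - α i)
  have hR := h.radius_pos ht
  have hchord : ∀ i j, planarSq (q i t) (q j t) = chordSq (√(ρ t ^ 2 - 1)) (α j - α i) := by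
    intro i j
    unfold planarSq chordSq
    rw [h.sq_sqrt_radius ht, ← h.radius t ht i, (hrot t ht i j).1, (hrot t ht i j).2]
    linear_combination (q i t 0 ^ 2 + q i t 1 ^ 2) * Real.sin_sq_add_cos_sq (α j - α i)
  let F : Fin n → ℝ := fun i => ∑ j ∈ Finset.univ.erase i,
    m j * pairForce (chordSq (√(ρ t ^ 2 - 1)) (α j - α i)) * Real.sin (α j - α i)
  have hder : ∀ i, HasDerivAt (fun s => q i s 0 * v i s 1 - q i s 1 * v i s 0)
      (-(ρ t ^ 2 - 1) * F i) t := by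
    intro i
    have h1 := ((h.velocity t ht i 0).mul (h.acceleration t ht i 1)).sub
      ((h.velocity t ht i 1).mul (h.acceleration t ht i 0))
    refine h1.congr_deriv ?_
    have e : -(ρ t ^ 2 - 1) * F i
        = q i t 0 * ∑ j ∈ Finset.univ.erase i,
            m j * pairForce (planarSq (q i t) (q j t)) * (q j t 1 - q i t 1)
          - q i t 1 * ∑ j ∈ Finset.univ.erase i,
            m j * pairForce (planarSq (q i t) (q j t)) * (q j t 0 - q i t 0) := by
      simp only [F]
      rw [Finset.mul_sum, Finset.mul_sum, Finset.mul_sum, ← Finset.sum_sub_distrib]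
      refine Finset.sum_congr rfl fun j _ => ?_
      rw [hchord, ← h.radius t ht i, (hrot t ht i j).1, (hrot t ht i j).2]
      ring
    rw [h.planar t ht i 0 (Or.inl rfl), h.planar t ht i 1 (Or.inr rfl), e]
    ring
  have hFeq : ∀ i j, F i = F j := by
    intro i j
    have := (hder i).unique ((hder j).congr_of_eventuallyEq
      ((h.eventually_mem ht).mono fun s hs => hang s hs i j))
    exact mul_left_cancel₀ (neg_ne_zero.2 hR.ne') this
  -- the total torque vanishes
  have htotal : ∑ i, m i * F i = 0 := by
    have e : ∀ i, m i * F i = ∑ j, m i * m j * (pairForce (chordSq (√(ρ t ^ 2 - 1)) (α j - α i))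
        * Real.sin (α j - α i)) := by
      intro i
      rw [← Finset.sum_erase (a := i) Finset.univ (by simp), Finset.mul_sum]
      exact Finset.sum_congr rfl fun j _ => by ring
    have e2 : ∑ i, m i * F i = -∑ i, m i * F i := by
      simp only [e]
      nth_rewrite 1 [Finset.sum_comm]
      rw [← Finset.sum_neg_distrib]
      refine Finset.sum_congr rfl fun i _ => ?_
      rw [← Finset.sum_neg_distrib]
      refine Finset.sum_congr rfl fun j _ => ?_
      rw [show α i - α j = -(α j - α i) by ring]
      simp only [chordSq, Real.cos_neg, Real.sin_neg]
      ring
    linarith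
  have hF0 : ∀ i, F i = 0 := by
    intro i
    have e : ∑ j, m j * F j = (∑ j, m j) * F i := by
      rw [Finset.sum_mul]
      exact Finset.sum_congr rfl fun j _ => by rw [hFeq j i]
    rw [e] at htotal
    exact (mul_eq_zero.1 htotal).resolve_left
      (Finset.sum_pos (fun j _ => hm j) ⟨i, Finset.mem_univ i⟩).ne'
  refine ⟨hF0, hang t ht, fun i => ?_⟩
  have := hder i
  rwa [hF0 i, mul_zero] at this

end IsPlanarMotion

section Rotopulsator

variable {n : ℕ} {m : Fin n → ℝ} {I : Set ℝ} {q : Fin n → ℝ → Fin 4 → ℝ} {ρ : ℝ → ℝ}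

/-- Both classes of rotopulsators reduce to rigid planar motions. -/
theorem IsRotopulsator.exists_isRigid (hm : ∀ i, 0 < m i) (hq : IsRotopulsator m I q ρ) :
    ∃ v a κ α, IsPlanarMotion m I q v a ρ κ ∧ IsRigid I q ρ α := by
  rcases hq with hq | hq
  · obtain ⟨v, a, κ, h⟩ := exists_isPlanarMotion hm hq.solution hq.form hq.polygon
    obtain ⟨α, hα⟩ := h.isRigid_of_sameShape hq.shape
    exact ⟨v, a, κ, α, h, hα⟩
  · obtain ⟨x, y, hform, r, θ, α, -, -, hr, -, hxy⟩ := hq.form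
    obtain ⟨v, a, κ, h⟩ := exists_isPlanarMotion hm hq.solution ⟨x, y, hform⟩ hq.polygon
    refine ⟨v, a, κ, α, h, fun t ht => ⟨-θ t, fun i => ?_⟩⟩
    obtain ⟨-, -, -, -, φ, β, -, hqf⟩ := hform
    have e := hxy i t ht
    rw [T_mulVec] at e
    have e0 := congrFun e 0
    have e1 := congrFun e 1
    simp only [Matrix.cons_val, Pi.smul_apply, smul_eq_mul] at e0 e1
    have hsqrt : √(ρ t ^ 2 - 1) = r t := by
      rw [show ρ t ^ 2 - 1 = r t ^ 2 by linarith [(hr t ht).2], Real.sqrt_sq (hr t ht).1]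
    rw [hqf i t ht, hsqrt]
    simp only [join, Matrix.cons_val]
    rw [e0, e1, Real.sin_add, Real.cos_add, Real.sin_neg, Real.cos_neg]
    constructor <;> ring

/-! ### The case of a nonconstant size function -/

/-- If the size function is not constant, the tangential forces balance for a whole interval of
radii, which forces the configuration to be a regular polygon. -/
theorem IsPlanarMotion.isRegularPolygon {v a : Fin n → ℝ → Fin 4 → ℝ} {κ : ℝ → ℝ}
    (h : IsPlanarMotion m I q v a ρ κ) (hm : ∀ i, 0 < m i) {α : Fin n → ℝ}
    (hα : IsRigid I q ρ α) {t₁ t₂ : ℝ} (ht₁ : t₁ ∈ I) (ht₂ : t₂ ∈ I) (hne : ρ t₁ ^ 2 < ρ t₂ ^ 2)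
    {t : ℝ} (ht : t ∈ I) : IsRegularPolygon (fun i => q i t) := by
  have hn := h.card
  let i₀ : Fin n := ⟨0, by omega⟩
  have hinj : ∀ i j, ∀ k : ℤ, α j - α i = 2 * Real.pi * k → i = j := by
    intro i j k hk
    by_contra hij
    have hpos := h.planarSq_pos t ht i j hij
    obtain ⟨ψ, hψ⟩ := hα t ht
    have e : ψ + α j = ψ + α i + k * (2 * Real.pi) := by linear_combination hk
    unfold planarSq at hpos
    rw [(hψ i).1, (hψ i).2, (hψ j).1, (hψ j).2, e, Real.sin_add_int_mul_two_pi,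
      Real.cos_add_int_mul_two_pi] at hpos
    simp at hpos
  have hcont : ContinuousOn (fun t => q i₀ t 0 ^ 2 + q i₀ t 1 ^ 2) I := fun t ht =>
    (((h.velocity t ht i₀ 0).continuousAt.pow 2).add
      ((h.velocity t ht i₀ 1).continuousAt.pow 2)).continuousWithinAt
  have hrefl := reflection_of_tangential hm α hinj (h.radius_pos ht₁).le
    (show ρ t₁ ^ 2 - 1 < ρ t₂ ^ 2 - 1 by linarith) (fun r hr hrI => by
      have himg := h.isPreconnected.intermediate_value ht₁ ht₂ hcont
      simp only [h.radius t₁ ht₁ i₀, h.radius t₂ ht₂ i₀] at himg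
      obtain ⟨s, hs, hsr⟩ := himg (Set.Ioo_subset_Icc_self hrI)
      have e : √(ρ s ^ 2 - 1) = r := by
        rw [← h.radius s hs i₀, show q i₀ s 0 ^ 2 + q i₀ s 1 ^ 2 = r ^ 2 from hsr,
          Real.sqrt_sq hr.le]
      rw [← e]
      exact (h.tangential hm hα hs).1)
  obtain ⟨τ, hτ⟩ := equally_spaced_of_reflection α i₀ hinj hrefl
  obtain ⟨ψ, hψ⟩ := hα t ht
  refine ⟨![0, 0, q i₀ t 2, q i₀ t 3], ![Real.sin (ψ + α i₀), Real.cos (ψ + α i₀), 0, 0],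
    ![Real.cos (ψ + α i₀), -Real.sin (ψ + α i₀), 0, 0], √(ρ t ^ 2 - 1), τ,
    Real.sqrt_pos.2 (h.radius_pos ht), ?_, ?_, ?_, ?_, ?_, fun k => ?_⟩
  · simp [mink, ← sq]
  · simp [mink, ← sq]
  · simp only [mink, Matrix.cons_val]
    ring
  · simp [mink]
  · simp [mink]
  · obtain ⟨l, hl⟩ := hτ k
    have e : ψ + α (τ k) = (ψ + α i₀) + 2 * Real.pi * k / n + l * (2 * Real.pi) := by
      linear_combination hl
    have e0 := (hψ (τ k)).1
    have e1 := (hψ (τ k)).2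
    rw [e, Real.sin_add_int_mul_two_pi, Real.sin_add] at e0
    rw [e, Real.cos_add_int_mul_two_pi, Real.cos_add] at e1
    have e2 := (h.coaxial t ht (τ k) i₀).1
    have e3 := (h.coaxial t ht (τ k) i₀).2
    ext d
    fin_cases d <;>
      simp only [Fin.zero_eta, Fin.mk_one, Fin.reduceFinMk, Pi.add_apply, Pi.smul_apply,
        smul_eq_mul, Matrix.cons_val]
    · linear_combination e0
    · linear_combination e1
    · linear_combination e2
    · linear_combination e3

/-! ### The case of a constant size function -/

/-- A differentiable function with vanishing derivative on an open interval is constant there. -/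
theorem eq_of_hasDerivAt_zero {f : ℝ → ℝ} (hI : IsOpen I) (hI' : IsPreconnected I)
    (hf : ∀ t ∈ I, HasDerivAt f 0 t) {s t : ℝ} (hs : s ∈ I) (ht : t ∈ I) : f s = f t :=
  hI.is_const_of_deriv_eq_zero hI'
    (fun t ht => (hf t ht).differentiableAt.differentiableWithinAt)
    (fun t ht => (hf t ht).deriv) hs ht

/-- If the size function is constant, both the planar and the hyperbolic angular momentum are
constant, so that the motion is a relative equilibrium. -/
theorem IsPlanarMotion.exists_isRelativeEquilibrium {v a : Fin n → ℝ → Fin 4 → ℝ} {κ : ℝ → ℝ}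
    (h : IsPlanarMotion m I q v a ρ κ) (hm : ∀ i, 0 < m i) {α : Fin n → ℝ}
    (hα : IsRigid I q ρ α) {c : ℝ} (hc : ∀ t ∈ I, ρ t = c) :
    ∃ A B Q, IsRelativeEquilibrium I q A B Q := by
  have hn := h.card
  let i₀ : Fin n := ⟨0, by omega⟩
  obtain ⟨t₀, ht₀⟩ := h.nonempty
  have hR : 0 < c ^ 2 - 1 := hc t₀ ht₀ ▸ h.radius_pos ht₀
  have hc0 : 0 < c ^ 2 := by linarith
  let ℓ : ℝ := q i₀ t₀ 0 * v i₀ t₀ 1 - q i₀ t₀ 1 * v i₀ t₀ 0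
  let μ : ℝ := q i₀ t₀ 3 * v i₀ t₀ 2 - q i₀ t₀ 2 * v i₀ t₀ 3
  have hℓ : ∀ t ∈ I, ∀ i, q i t 0 * v i t 1 - q i t 1 * v i t 0 = ℓ := by
    intro t ht i
    rw [(h.tangential hm hα ht).2.1 i i₀]
    exact eq_of_hasDerivAt_zero h.isOpen h.isPreconnected
      (fun s hs => (h.tangential hm hα hs).2.2 i₀) ht ht₀
  have hvco : ∀ t ∈ I, ∀ i, v i t 2 = v i₀ t 2 ∧ v i t 3 = v i₀ t 3 := by
    intro t ht i
    exact ⟨(h.velocity t ht i 2).unique ((h.velocity t ht i₀ 2).congr_of_eventuallyEq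
        ((h.eventually_mem ht).mono fun s hs => (h.coaxial s hs i i₀).1)),
      (h.velocity t ht i 3).unique ((h.velocity t ht i₀ 3).congr_of_eventuallyEq
        ((h.eventually_mem ht).mono fun s hs => (h.coaxial s hs i i₀).2))⟩
  have hμ : ∀ t ∈ I, ∀ i, q i t 3 * v i t 2 - q i t 2 * v i t 3 = μ := by
    intro t ht i
    rw [(h.coaxial t ht i i₀).1, (h.coaxial t ht i i₀).2, (hvco t ht i).1, (hvco t ht i).2]
    refine eq_of_hasDerivAt_zero (f := fun t => q i₀ t 3 * v i₀ t 2 - q i₀ t 2 * v i₀ t 3)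
      h.isOpen h.isPreconnected (fun s hs => ?_) ht ht₀
    refine (((h.velocity s hs i₀ 3).mul (h.acceleration s hs i₀ 2)).sub
      ((h.velocity s hs i₀ 2).mul (h.acceleration s hs i₀ 3))).congr_deriv ?_
    rw [h.axial s hs i₀ 2 (Or.inl rfl), h.axial s hs i₀ 3 (Or.inr rfl)]
    ring
  have hrad : ∀ t ∈ I, ∀ i, q i t 0 * v i t 0 + q i t 1 * v i t 1 = 0 := by
    intro t ht i
    have h1 := ((h.velocity t ht i 0).pow 2).add ((h.velocity t ht i 1).pow 2)
    have h2 := h1.unique ((hasDerivAt_const t (c ^ 2 - 1)).congr_of_eventuallyEq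
      ((h.eventually_mem ht).mono fun s hs => by
        simpa [hc s hs] using h.radius s hs i))
    simp at h2
    linarith
  have hhei : ∀ t ∈ I, ∀ i, q i t 3 * v i t 3 - q i t 2 * v i t 2 = 0 := by
    intro t ht i
    have h1 := ((h.velocity t ht i 3).pow 2).sub ((h.velocity t ht i 2).pow 2)
    have h2 := h1.unique ((hasDerivAt_const t (c ^ 2)).congr_of_eventuallyEq
      ((h.eventually_mem ht).mono fun s hs => by
        simpa [hc s hs] using h.height s hs i))
    simp at h2
    linarith
  let A : ℝ := ℓ / (c ^ 2 - 1)
  let B : ℝ := μ / c ^ 2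
  have hv : ∀ t ∈ I, ∀ i, v i t 0 = -A * q i t 1 ∧ v i t 1 = A * q i t 0 ∧
      v i t 2 = B * q i t 3 ∧ v i t 3 = B * q i t 2 := by
    intro t ht i
    have eR := h.radius t ht i
    have eH := h.height t ht i
    rw [hc t ht] at eR eH
    have hA : A * (c ^ 2 - 1) = ℓ := div_mul_cancel₀ _ hR.ne'
    have hB : B * c ^ 2 = μ := div_mul_cancel₀ _ hc0.ne'
    have e1 := hℓ t ht i
    have e2 := hμ t ht i
    have e3 := hrad t ht i
    have e4 := hhei t ht i
    refine ⟨mul_left_cancel₀ hR.ne' ?_, mul_left_cancel₀ hR.ne' ?_, mul_left_cancel₀ hc0.ne' ?_,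
      mul_left_cancel₀ hc0.ne' ?_⟩
    · linear_combination -v i t 0 * eR + q i t 1 * hA + q i t 0 * e3 - q i t 1 * e1
    · linear_combination -v i t 1 * eR - q i t 0 * hA + q i t 1 * e3 + q i t 0 * e1
    · linear_combination -v i t 2 * eH - q i t 3 * hB + q i t 3 * e2 + q i t 2 * e4
    · linear_combination -v i t 3 * eH - q i t 2 * hB + q i t 2 * e2 + q i t 3 * e4
  -- the configuration, carried back by the rotation of time `t`
  let G : Fin n → ℝ → Fin 4 → ℝ := fun i t =>
    ![Real.cos (A * t) * q i t 0 + Real.sin (A * t) * q i t 1,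
      Real.cos (A * t) * q i t 1 - Real.sin (A * t) * q i t 0,
      Real.cosh (B * t) * q i t 2 - Real.sinh (B * t) * q i t 3,
      Real.cosh (B * t) * q i t 3 - Real.sinh (B * t) * q i t 2]
  have hG : ∀ t ∈ I, ∀ i, G i t = G i t₀ := by
    intro t ht i
    have dA : ∀ s, HasDerivAt (fun s => A * s) A s := fun s => by
      simpa using (hasDerivAt_id s).const_mul A
    have dB : ∀ s, HasDerivAt (fun s => B * s) B s := fun s => by
      simpa using (hasDerivAt_id s).const_mul B
    ext k
    refine eq_of_hasDerivAt_zero (f := fun t => G i t k) h.isOpen h.isPreconnected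
      (fun s hs => ?_) ht ht₀
    obtain ⟨v0, v1, v2, v3⟩ := hv s hs i
    have d := h.velocity s hs i
    fin_cases k <;>
      simp only [G, Fin.zero_eta, Fin.mk_one, Fin.reduceFinMk, Matrix.cons_val]
    · refine (((dA s).cos.mul (d 0)).add ((dA s).sin.mul (d 1))).congr_deriv ?_
      rw [v0, v1]; ring
    · refine (((dA s).cos.mul (d 1)).sub ((dA s).sin.mul (d 0))).congr_deriv ?_
      rw [v0, v1]; ring
    · refine (((dB s).cosh.mul (d 2)).sub ((dB s).sinh.mul (d 3))).congr_deriv ?_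
      rw [v2, v3]; ring
    · refine (((dB s).cosh.mul (d 3)).sub ((dB s).sinh.mul (d 2))).congr_deriv ?_
      rw [v2, v3]; ring
  refine ⟨A, B, fun i => G i t₀, fun i t ht => ?_⟩
  simp only [← hG t ht i]
  rw [rotate_eq]
  have e1 := Real.sin_sq_add_cos_sq (A * t)
  have e2 := Real.cosh_sq_sub_sinh_sq (B * t)
  ext k
  fin_cases k <;>
    simp only [G, Fin.zero_eta, Fin.mk_one, Fin.reduceFinMk, Matrix.cons_val]
  · linear_combination -q i t 0 * e1
  · linear_combination -q i t 1 * e1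
  · linear_combination -q i t 2 * e2
  · linear_combination -q i t 3 * e2

/-- A planar motion that is a relative equilibrium with rates `A`, `B` is a central configuration
with constant `A ^ 2 + B ^ 2`. -/
theorem IsPlanarMotion.isCentralConfiguration {v a : Fin n → ℝ → Fin 4 → ℝ} {κ : ℝ → ℝ}
    (h : IsPlanarMotion m I q v a ρ κ) {A B : ℝ} {Q : Fin n → Fin 4 → ℝ}
    (hQ : IsRelativeEquilibrium I q A B Q) {t : ℝ} (ht : t ∈ I) {α : Fin n → ℝ}
    (hα : ∀ i, ∃ s : ℝ, 0 < s ∧ Q i 0 = s * Real.sin (α i) ∧ Q i 1 = s * Real.cos (α i)) :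
    IsCentralConfiguration m (√(ρ t ^ 2 - 1)) (A ^ 2 + B ^ 2) α ∧
    (∀ i, Q i 0 = √(ρ t ^ 2 - 1) * Real.sin (α i) ∧ Q i 1 = √(ρ t ^ 2 - 1) * Real.cos (α i)) ∧
    (∀ i j, Q i 2 = Q j 2 ∧ Q i 3 = Q j 3) ∧ (∀ i, 0 < Q i 3) ∧
    ∀ i, Q i 3 ^ 2 - Q i 2 ^ 2 = ρ t ^ 2 := by
  have hn := h.card
  have hR := h.radius_pos ht
  have hr : 0 < √(ρ t ^ 2 - 1) := Real.sqrt_pos.2 hR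
  have hr2 := h.sq_sqrt_radius ht
  set r := √(ρ t ^ 2 - 1) with hrdef
  have hq : ∀ s ∈ I, ∀ i,
      q i s 0 = Real.cos (A * s) * Q i 0 - Real.sin (A * s) * Q i 1 ∧
      q i s 1 = Real.sin (A * s) * Q i 0 + Real.cos (A * s) * Q i 1 ∧
      q i s 2 = Real.cosh (B * s) * Q i 2 + Real.sinh (B * s) * Q i 3 ∧
      q i s 3 = Real.sinh (B * s) * Q i 2 + Real.cosh (B * s) * Q i 3 := by
    intro s hs i
    rw [hQ i s hs, rotate_eq]
    simp
  have hnorm : ∀ i, Q i 0 = r * Real.sin (α i) ∧ Q i 1 = r * Real.cos (α i) := by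
    intro i
    obtain ⟨s, hs, h0, h1⟩ := hα i
    have e := h.radius t ht i
    rw [(hq t ht i).1, (hq t ht i).2.1, h0, h1, ← hr2] at e
    have : s ^ 2 = r ^ 2 := by
      rw [← e]
      linear_combination -s ^ 2 * Real.sin_sq_add_cos_sq (A * t)
        - s ^ 2 * (Real.sin (A * t) ^ 2 + Real.cos (A * t) ^ 2)
          * (Real.sin_sq_add_cos_sq (α i))
    have hsr : s = r := (sq_eq_sq₀ hs.le hr.le).1 this
    rw [h0, h1, hsr]
    exact ⟨rfl, rfl⟩
  have hbs : Real.cosh (B * t) ^ 2 - Real.sinh (B * t) ^ 2 = 1 := Real.cosh_sq_sub_sinh_sq _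
  have hco : ∀ i, Q i 2 = Real.cosh (B * t) * q i t 2 - Real.sinh (B * t) * q i t 3 ∧
      Q i 3 = Real.cosh (B * t) * q i t 3 - Real.sinh (B * t) * q i t 2 := by
    intro i
    rw [(hq t ht i).2.2.1, (hq t ht i).2.2.2]
    constructor
    · linear_combination -Q i 2 * hbs
    · linear_combination -Q i 3 * hbs
  have hheight : ∀ i, Q i 3 ^ 2 - Q i 2 ^ 2 = ρ t ^ 2 := by
    intro i
    rw [← h.height t ht i, (hq t ht i).2.2.1, (hq t ht i).2.2.2]
    linear_combination -(Q i 3 ^ 2 - Q i 2 ^ 2) * hbs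
  have hupper : ∀ i, 0 < Q i 3 := by
    intro i
    rw [(hco i).2]
    have h1 : |q i t 2| < q i t 3 :=
      abs_lt_of_sq_lt_sq (by linarith [h.height t ht i]) (h.upper t ht i).le
    have h2 : |Real.sinh (B * t)| < Real.cosh (B * t) :=
      abs_lt_of_sq_lt_sq (by linarith) (Real.cosh_pos _).le
    have h3 : Real.sinh (B * t) * q i t 2 < Real.cosh (B * t) * q i t 3 :=
      (le_abs_self _).trans_lt (by rw [abs_mul]; gcongr)
    linarith
  have hc : ∀ s, HasDerivAt (fun s => Real.cos (A * s)) (-A * Real.sin (A * s)) s := fun s => by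
    refine (((hasDerivAt_id s).const_mul A).cos).congr_deriv ?_
    simp; ring
  have hs : ∀ s, HasDerivAt (fun s => Real.sin (A * s)) (A * Real.cos (A * s)) s := fun s => by
    refine (((hasDerivAt_id s).const_mul A).sin).congr_deriv ?_
    simp; ring
  have hch : ∀ s, HasDerivAt (fun s => Real.cosh (B * s)) (B * Real.sinh (B * s)) s := fun s => by
    refine (((hasDerivAt_id s).const_mul B).cosh).congr_deriv ?_
    simp; ring
  have hsh : ∀ s, HasDerivAt (fun s => Real.sinh (B * s)) (B * Real.cosh (B * s)) s := fun s => by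
    refine (((hasDerivAt_id s).const_mul B).sinh).congr_deriv ?_
    simp; ring
  have hv : ∀ s ∈ I, ∀ i, v i s 0 = -A * q i s 1 ∧ v i s 1 = A * q i s 0 ∧
      v i s 2 = B * q i s 3 ∧ v i s 3 = B * q i s 2 := by
    intro s hs' i
    have ev := h.eventually_mem hs'
    obtain ⟨e0, e1, e2, e3⟩ := hq s hs' i
    refine ⟨?_, ?_, ?_, ?_⟩
    · rw [(h.velocity s hs' i 0).unique ((((hc s).mul_const (Q i 0)).sub
        ((hs s).mul_const (Q i 1))).congr_of_eventuallyEq (ev.mono fun s hs => (hq s hs i).1)), e1]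
      ring
    · rw [(h.velocity s hs' i 1).unique ((((hs s).mul_const (Q i 0)).add
        ((hc s).mul_const (Q i 1))).congr_of_eventuallyEq
          (ev.mono fun s hs => (hq s hs i).2.1)), e0]
      ring
    · rw [(h.velocity s hs' i 2).unique ((((hch s).mul_const (Q i 2)).add
        ((hsh s).mul_const (Q i 3))).congr_of_eventuallyEq
          (ev.mono fun s hs => (hq s hs i).2.2.1)), e3]
      ring
    · rw [(h.velocity s hs' i 3).unique ((((hsh s).mul_const (Q i 2)).add
        ((hch s).mul_const (Q i 3))).congr_of_eventuallyEq
          (ev.mono fun s hs => (hq s hs i).2.2.2)), e2]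
      ring
  have ha : ∀ i, a i t 0 = -A ^ 2 * q i t 0 ∧ a i t 1 = -A ^ 2 * q i t 1 ∧
      a i t 3 = B ^ 2 * q i t 3 := by
    intro i
    have ev := h.eventually_mem ht
    obtain ⟨e0, e1, e2, e3⟩ := hv t ht i
    refine ⟨?_, ?_, ?_⟩
    · rw [(h.acceleration t ht i 0).unique (((h.velocity t ht i 1).const_mul
        (-A)).congr_of_eventuallyEq
        (ev.mono fun s hs => (hv s hs i).1)), e1]
      ring
    · rw [(h.acceleration t ht i 1).unique (((h.velocity t ht i 0).const_mul
        A).congr_of_eventuallyEq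
        (ev.mono fun s hs => (hv s hs i).2.1)), e0]
      ring
    · rw [(h.acceleration t ht i 3).unique (((h.velocity t ht i 2).const_mul
        B).congr_of_eventuallyEq
        (ev.mono fun s hs => (hv s hs i).2.2.2)), e2]
      ring
  -- the last coordinate determines the common central force
  have hκ : κ t = B ^ 2 := by
    let i₀ : Fin n := ⟨0, by omega⟩
    have e := h.axial t ht i₀ 3 (Or.inr rfl)
    rw [(ha i₀).2.2] at e
    exact (mul_right_cancel₀ (h.upper t ht i₀).ne' e).symm
  have hang : ∀ i, q i t 0 = r * Real.sin (α i - A * t) ∧ q i t 1 = r * Real.cos (α i - A * t) := by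
    intro i
    rw [(hq t ht i).1, (hq t ht i).2.1, (hnorm i).1, (hnorm i).2, Real.sin_sub, Real.cos_sub]
    constructor <;> ring
  have hcs : ∀ i j,
      q i t 0 * q j t 0 + q i t 1 * q j t 1 = r ^ 2 * Real.cos (α j - α i) ∧
      q i t 1 * q j t 0 - q i t 0 * q j t 1 = r ^ 2 * Real.sin (α j - α i) := by
    intro i j
    rw [(hang i).1, (hang i).2, (hang j).1, (hang j).2,
      show α j - α i = (α j - A * t) - (α i - A * t) by ring, Real.cos_sub (α j - A * t),
      Real.sin_sub (α j - A * t)]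
    constructor <;> ring
  have hchord : ∀ i j, planarSq (q i t) (q j t) = chordSq r (α j - α i) := by
    intro i j
    unfold planarSq chordSq
    linear_combination h.radius t ht i + h.radius t ht j - 2 * hr2 - 2 * (hcs i j).1
  have hforce : ∀ i, ∀ k : Fin 4, k = 0 ∨ k = 1 →
      ∑ j ∈ Finset.univ.erase i, m j * pairForce (chordSq r (α j - α i)) * (q j t k - q i t k)
        = -(A ^ 2 + B ^ 2) * q i t k := by
    intro i k hk
    have e := h.planar t ht i k hk
    have e' : a i t k = -A ^ 2 * q i t k := by
      rcases hk with rfl | rfl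
      · exact (ha i).1
      · exact (ha i).2.1
    rw [e', hκ] at e
    simp only [hchord] at e
    linear_combination -e
  refine ⟨⟨hr, fun i => ?_, fun i => ?_⟩, hnorm, fun i j => ?_, hupper, hheight⟩
  · refine (mul_eq_zero.1 ?_).resolve_left (pow_pos hr 2).ne'
    have e0 := hforce i 0 (Or.inl rfl)
    have e1 := hforce i 1 (Or.inr rfl)
    have : r ^ 2 * ∑ j ∈ Finset.univ.erase i,
          m j * pairForce (chordSq r (α j - α i)) * Real.sin (α j - α i)
        = q i t 1 * ∑ j ∈ Finset.univ.erase i,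
            m j * pairForce (chordSq r (α j - α i)) * (q j t 0 - q i t 0)
          - q i t 0 * ∑ j ∈ Finset.univ.erase i,
            m j * pairForce (chordSq r (α j - α i)) * (q j t 1 - q i t 1) := by
      rw [Finset.mul_sum, Finset.mul_sum, Finset.mul_sum, ← Finset.sum_sub_distrib]
      refine Finset.sum_congr rfl fun j _ => ?_
      linear_combination -(m j * pairForce (chordSq r (α j - α i))) * (hcs i j).2
    rw [this, e0, e1]
    ring
  · refine mul_left_cancel₀ (pow_pos hr 2).ne' ?_
    have e0 := hforce i 0 (Or.inl rfl)
    have e1 := hforce i 1 (Or.inr rfl)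
    have : r ^ 2 * ∑ j ∈ Finset.univ.erase i,
          m j * pairForce (chordSq r (α j - α i)) * (1 - Real.cos (α j - α i))
        = -(q i t 0 * ∑ j ∈ Finset.univ.erase i,
            m j * pairForce (chordSq r (α j - α i)) * (q j t 0 - q i t 0)
          + q i t 1 * ∑ j ∈ Finset.univ.erase i,
            m j * pairForce (chordSq r (α j - α i)) * (q j t 1 - q i t 1)) := by
      rw [Finset.mul_sum, Finset.mul_sum, Finset.mul_sum, ← Finset.sum_add_distrib,
        ← Finset.sum_neg_distrib]
      refine Finset.sum_congr rfl fun j _ => ?_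
      linear_combination (m j * pairForce (chordSq r (α j - α i)))
        * ((hcs i j).1 - h.radius t ht i + hr2)
    rw [this, e0, e1, hr2]
    linear_combination (A ^ 2 + B ^ 2) * h.radius t ht i
  · rw [(hco i).1, (hco i).2, (hco j).1, (hco j).2, (h.coaxial t ht i j).1, (h.coaxial t ht i j).2]
    exact ⟨rfl, rfl⟩

end Rotopulsator

/-- A common hyperbolic rotation carries one point of a branch of a hyperbola to another. -/
theorem exists_boost {z w z' w' R : ℝ} (hw : 0 < w) (hw' : 0 < w')
    (hR : 0 < R) (h : w ^ 2 - z ^ 2 = R) (h' : w' ^ 2 - z' ^ 2 = R) :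
    ∃ b, z' = Real.cosh b * z + Real.sinh b * w ∧ w' = Real.sinh b * z + Real.cosh b * w := by
  refine ⟨Real.arsinh ((w * z' - z * w') / R), ?_⟩
  have hs := Real.sinh_arsinh ((w * z' - z * w') / R)
  have hpos : 0 ≤ (w * w' - z * z') / R := by
    have h1 : |z| ≤ w := abs_le_of_sq_le_sq (by linarith) hw.le
    have h2 : |z'| ≤ w' := abs_le_of_sq_le_sq (by linarith) hw'.le
    have h3 : z * z' ≤ w * w' := (le_abs_self _).trans (by rw [abs_mul]; gcongr)
    exact div_nonneg (by linarith) hR.le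
  have hc : Real.cosh (Real.arsinh ((w * z' - z * w') / R)) = (w * w' - z * z') / R := by
    rw [Real.cosh_arsinh, ← Real.sqrt_sq hpos]
    congr 1
    field_simp
    nth_rewrite 1 [sq R]
    nth_rewrite 1 [← h]
    rw [← h']
    ring
  rw [hc, hs]
  constructor
  · field_simp
    rw [← h]
    ring
  · field_simp
    rw [← h]
    ring

/-- Points with pairwise distinct projections on a circle are met in some cyclic order. -/
theorem exists_hasCyclicOrder {n : ℕ} {Q : Fin n → Fin 4 → ℝ} {r : ℝ} (hr : 0 < r)
    (hQ : ∀ i, Q i 0 ^ 2 + Q i 1 ^ 2 = r ^ 2) (hinj : ∀ i j, i ≠ j → 0 < planarSq (Q i) (Q j)) :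
    ∃ σ, HasCyclicOrder σ Q := by
  choose α hα h0 h1 using fun i => exists_angle hr (hQ i)
  have hαinj : Function.Injective α := by
    intro i j hij
    by_contra hne
    have := hinj i j hne
    rw [planarSq, h0, h1, h0 j, h1 j, hij] at this
    simp at this
  refine ⟨Tuple.sort α, α, (Tuple.monotone_sort α).strictMono_of_injective
    (hαinj.comp (Tuple.sort α).injective), fun i j => ?_, fun i => ⟨r, hr, h0 i, h1 i⟩⟩
  linarith [(hα i).2, (hα j).1]

theorem StrictMono.angle_sub_mem {n : ℕ} {σ : Equiv.Perm (Fin n)} {α : Fin n → ℝ}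
    (hσ : StrictMono (α ∘ σ)) (hlt : ∀ i j, α i - α j < 2 * Real.pi) {i j : Fin n}
    (hij : σ.symm i < σ.symm j) : α j - α i ∈ Set.Ioo 0 (2 * Real.pi) := by
  have := hσ hij
  simp only [Function.comp_apply, Equiv.apply_symm_apply] at this
  exact ⟨by linarith, hlt j i⟩

end

theorem theorem1 {n : ℕ} (m : Fin n → ℝ) (hm : ∀ i, 0 < m i) (I : Set ℝ)
    (q : Fin n → ℝ → Fin 4 → ℝ) (ρ : ℝ → ℝ) (hq : IsRotopulsator m I q ρ) :
    ((¬ ∃ c : ℝ, ∀ t ∈ I, ρ t = c) → ∀ t ∈ I, IsRegularPolygon (fun i => q i t)) ∧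
    (∀ c : ℝ, (∀ t ∈ I, ρ t = c) →
      ∃ (A B : ℝ) (Q : Fin n → Fin 4 → ℝ) (σ : Equiv.Perm (Fin n)),
        IsRelativeEquilibrium I q A B Q ∧ HasCyclicOrder σ Q ∧
        ∀ (I' : Set ℝ) (q' : Fin n → ℝ → Fin 4 → ℝ) (ρ' : ℝ → ℝ) (c' A' B' : ℝ)
          (Q' : Fin n → Fin 4 → ℝ),
          IsRotopulsator m I' q' ρ' → (∀ t ∈ I', ρ' t = c') →
          IsRelativeEquilibrium I' q' A' B' Q' → HasCyclicOrder σ Q' →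
          (c' = c ∨ A' ^ 2 + B' ^ 2 = A ^ 2 + B ^ 2) →
          ∃ a b : ℝ, ∀ i, Q' i = rotate a b (Q i)) := by
  obtain ⟨v, a, κ, α, h, hα⟩ := hq.exists_isRigid hm
  have hn := h.card
  refine ⟨fun hnc t ht => ?_, fun c hc => ?_⟩
  -- as `ρ ≥ 0`, different values of `ρ` give different radii
  · have hρ0 : ∀ t ∈ I, 0 ≤ ρ t := by
      rcases hq with hq | hq
      · obtain ⟨x, y, -, hρ0, -⟩ := hq.form
        exact hρ0
      · obtain ⟨x, y, ⟨-, hρ0, -⟩, -⟩ := hq.form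
        exact hρ0
    have : ∃ s ∈ I, ρ s ≠ ρ t := by
      by_contra! hcon
      exact hnc ⟨ρ t, hcon⟩
    obtain ⟨s, hs, hne⟩ := this
    rcases lt_or_gt_of_ne hne with hlt | hlt
    · exact h.isRegularPolygon hm hα hs ht (pow_lt_pow_left₀ hlt (hρ0 s hs) two_ne_zero) ht
    · exact h.isRegularPolygon hm hα ht hs (pow_lt_pow_left₀ hlt (hρ0 t ht) two_ne_zero) ht
  · obtain ⟨A, B, Q, hQ⟩ := h.exists_isRelativeEquilibrium hm hα hc
    obtain ⟨t, ht⟩ := h.nonempty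
    have hr := Real.sqrt_pos.2 (h.radius_pos ht)
    have hplane : ∀ i, q i t 0 = Real.cos (A * t) * Q i 0 - Real.sin (A * t) * Q i 1 ∧
        q i t 1 = Real.sin (A * t) * Q i 0 + Real.cos (A * t) * Q i 1 := by
      intro i
      rw [hQ i t ht, rotate_eq]
      simp
    have hcs := Real.sin_sq_add_cos_sq (A * t)
    obtain ⟨σ, hσ⟩ := exists_hasCyclicOrder (Q := Q) hr
      (fun i => by
        rw [h.sq_sqrt_radius ht, ← h.radius t ht i, (hplane i).1, (hplane i).2]
        linear_combination -(Q i 0 ^ 2 + Q i 1 ^ 2) * hcs)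
      (fun i j hij => by
        have hpos := h.planarSq_pos t ht i j hij
        unfold planarSq at hpos ⊢
        rw [(hplane i).1, (hplane i).2, (hplane j).1, (hplane j).2] at hpos
        refine hpos.trans_eq ?_
        linear_combination ((Q i 0 - Q j 0) ^ 2 + (Q i 1 - Q j 1) ^ 2) * hcs)
    refine ⟨A, B, Q, σ, hQ, hσ, ?_⟩
    intro I' q' ρ' c' A' B' Q' hq' hc' hQ' hσ' hor
    obtain ⟨v', a', κ', -, h', -⟩ := hq'.exists_isRigid hm
    obtain ⟨t', ht'⟩ := h'.nonempty
    obtain ⟨γ, hγ, hγlt, hγQ⟩ := hσ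
    obtain ⟨γ', hγ', hγlt', hγQ'⟩ := hσ'
    obtain ⟨hC, hang, hco, hup, hhei⟩ := h.isCentralConfiguration hQ ht hγQ
    obtain ⟨hC', hang', hco', hup', hhei'⟩ := h'.isCentralConfiguration hQ' ht' hγQ'
    have hrt := h.sq_sqrt_radius ht
    have hrt' := h'.sq_sqrt_radius ht'
    have hRc := h.radius_pos ht
    simp only [hc t ht] at hr hC hang hhei hrt hRc
    simp only [hc' t' ht'] at hC' hang' hhei' hrt'
    have hr' := hC'.radius_pos
    obtain ⟨hrr, hδ⟩ := hC.unique hn hm hC'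
      (fun i j hij => by
        rcases lt_or_gt_of_ne (σ.symm.injective.ne hij) with hlt | hlt
        · exact Or.inl ⟨hγ.angle_sub_mem hγlt hlt, hγ'.angle_sub_mem hγlt' hlt⟩
        · exact Or.inr ⟨hγ.angle_sub_mem hγlt hlt, hγ'.angle_sub_mem hγlt' hlt⟩)
      (by
        rcases hor with rfl | hω
        · simp
        -- for a common `ω`, the sign condition is monotonicity of the logarithm
        · rw [hω, ← mul_sub, mul_assoc]
          refine mul_nonneg (by positivity) ?_
          rcases le_total (√(c ^ 2 - 1)) (√(c' ^ 2 - 1)) with hle | hle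
          · exact mul_nonneg (sub_nonneg.2 (by gcongr)) (sub_nonneg.2 (Real.log_le_log hr hle))
          · exact mul_nonneg_of_nonpos_of_nonpos (sub_nonpos.2 (by gcongr))
              (sub_nonpos.2 (Real.log_le_log hr' hle)))
    have hcc : c' ^ 2 = c ^ 2 := by
      rw [hrr, hrt] at hrt'
      linarith
    let i₀ : Fin n := ⟨0, by omega⟩
    obtain ⟨b, hb2, hb3⟩ := exists_boost (hup i₀) (hup' i₀) (by linarith)
      (hhei i₀) ((hhei' i₀).trans hcc)
    -- angles are measured as in `(sin, cos)`, so `rotate a` lowers them by `a`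
    refine ⟨-(γ' i₀ - γ i₀), b, fun i => ?_⟩
    have hi : γ' i = γ i - -(γ' i₀ - γ i₀) := by linarith [hδ i i₀]
    have e0 := (hang' i).1
    have e1 := (hang' i).2
    rw [hrr, hi, Real.sin_sub] at e0
    rw [hrr, hi, Real.cos_sub] at e1
    rw [rotate_eq, (hang i).1, (hang i).2, (hco i i₀).1, (hco i i₀).2]
    ext k
    fin_cases k <;> simp only [Fin.zero_eta, Fin.mk_one, Fin.reduceFinMk, Matrix.cons_val]
    · linear_combination e0
    · linear_combination e1
    · rw [(hco' i i₀).1]; exact hb2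
    · rw [(hco' i i₀).2]; exact hb3
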